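/- Let $\mathcal S$ be a finite or countable set, $p=(p_{jk})_{j,k\in\mathcal S}$ an irreducible and recurrent stochastic matrix, and $(m_j)_{j\in\mathcal S}$ a stationary measure of $p$ with $m_j>0$ for all $j$. For a probability measure $\mu$ on $\mathcal S$, the two-sided Markov chain with transition matrix $p$ and initial distribution $\mu$ is the process $(X_n)_{n\in\mathbb Z}$ such that $X_0$ has law $\mu$ and, given $X_0$, the processes $(X_n)_{n\ge 0}$ and $(X_{-n})_{n\ge 0}$ are independent Markov chains with transition matrix $p$ and with the dual transition matrix $p^*_{jk}=\frac{m_k}{m_j}p_{kj}$, respectively; that is, for all integers $a,b\ge0$ and all $x_{-a},\dots,x_b\in\mathcal S$, $$\mathbb P(X_k=x_k,\ -a\le k\le b)=\mu_{x_0}\prod_{k=0}^{b-1}p_{x_kx_{k+1}}\prod_{k=0}^{a-1}p^*_{x_{-k}x_{-k-1}}.$$ For $j\in\mathcal S$ and finite $A\subset\mathbb Z$ let $L^j(A)=\frac1{m_j}\#\{n\in A: X_n=j\}$. Theorem. Let $X$ be the two-sided Markov chain with transition matrix $p$ and initial state $X_0=i$, defined on a probability space with probability measure $\mathbb P_i$,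 and let $\nu=(\nu_j)_{j\in\mathcal S}$ be a probability measure on $\mathcal S$ with $\nu_i=0$ and $\frac{m_i}{m_j}\nu_j\in\mathbb Z$ for all $j\in\mathcal S$. Let $$T_*=\min\Big\{n\ge 0:\ L^i([0,n])\le\sum_{j\in\mathcal S}\nu_j L^j([0,n])\Big\},\qquad \min\emptyset=\infty,$$ where $[0,n]=\{0,1,\dots,n\}$. Then: 1. $T_*<\infty$ $\mathbb P_i$-almost surely; 2. $T_*$ is non-randomized, i.e. a measurable function of the trajectory $(X_n)_{n\in\mathbb Z}$; 3. $T_*$ is a stopping time with respect to the filtration $\sigma(X_0,\dots,X_n)$, $n\ge0$; 4. $T_*$ is an unbiased shift embedding $\nu$: under $\mathbb P_i$, the process $(X_{n+T_*})_{n\in\mathbb Z}$ is the two-sided Markov chain with transition matrix $p$ and initial distribution $\nu$; in particular $X_{T_*}$ has law $\nu$. -/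

import Mathlib

open MeasureTheory ProbabilityTheory

namespace TwoSidedChain

/-- A stochastic matrix on a (finite or countable) state space. -/
structure IsStochastic {S : Type*} (p : Matrix S S ℝ) : Prop where
  nonneg : ∀ i j, 0 ≤ p i j
  row_sum : ∀ i, HasSum (p i) 1

/-- `firstPassage p j n i` is the probability that the chain with transition matrix `p`
started in `i` visits `j` for the first time after time zero at time `n + 1`. -/
noncomputable def firstPassage {S : Type*} [DecidableEq S] (p : Matrix S S ℝ) (j : S) :
    ℕ → S → ℝ
  | 0, i => p i j
  | n + 1, i => ∑' k, if k = j then 0 else p i k * firstPassage p j n k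

/-- Every state is revisited in finite time with probability one. -/
def IsRecurrent {S : Type*} [DecidableEq S] (p : Matrix S S ℝ) : Prop :=
  ∀ i, HasSum (fun n => firstPassage p i n i) 1

/-- `m` is a stationary measure of `p` with positive weights (possibly of infinite total mass). -/
structure IsStationary {S : Type*} (p : Matrix S S ℝ) (m : S → ℝ) : Prop where
  pos : ∀ i, 0 < m i
  stationary : ∀ j, HasSum (fun i => m i * p i j) (m j)

/-- A probability measure on `S`, given by its weights. -/
structure IsProbability {S : Type*} (μ : S → ℝ) : Prop where
  nonneg : ∀ j, 0 ≤ μ j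
  sum_one : HasSum μ 1

/-- The dual transition probabilities `p*ᵢⱼ = (mⱼ / mᵢ) pⱼᵢ`. -/
noncomputable def dual {S : Type*} (p : Matrix S S ℝ) (m : S → ℝ) : Matrix S S ℝ :=
  fun i j => m j / m i * p j i

/-- Under `P`, the process `X` is the two-sided Markov chain with transition matrix `p` and initial
distribution `μ`: `X 0` has law `μ` and, given `X 0`, the forward chain `(X n)_{n ≥ 0}` and the
backward chain `(X (-n))_{n ≥ 0}` are independent Markov chains with transition matrix `p`,
respectively with the dual transition matrix. This is expressed by the probabilities of all
cylinder sets on the time windows `[-a, b]`. -/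
structure IsTwoSidedMarkovChain {S Ω : Type*} [MeasurableSpace S] [MeasurableSpace Ω]
    (p : Matrix S S ℝ) (m μ : S → ℝ) (X : ℤ → Ω → S) (P : Measure Ω) : Prop where
  measurable : ∀ n, Measurable (X n)
  cylinder : ∀ (a b : ℕ) (x : ℤ → S),
    P.real {ω | ∀ k : ℤ, -(a : ℤ) ≤ k → k ≤ (b : ℤ) → X k ω = x k} =
      μ (x 0) * (∏ k ∈ Finset.range b, p (x (k : ℤ)) (x ((k : ℤ) + 1))) *
        ∏ k ∈ Finset.range a, dual p m (x (-(k : ℤ))) (x (-(k : ℤ) - 1))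

/-- The local time `Lʲ(A) = #{n ∈ A : wₙ = j} / mⱼ` of the trajectory `w` at the state `j`,
for a finite set `A` of times. -/
noncomputable def localTime {S : Type*} [DecidableEq S] (m : S → ℝ) (w : ℤ → S) (j : S)
    (A : Finset ℤ) : ℝ :=
  ((A.filter fun n => w n = j).card : ℝ) / m j

/-- `T_* = min {n ≥ 0 : Lⁱ([0,n]) ≤ ∑ⱼ νⱼ Lʲ([0,n])}` as a function of the trajectory, with value
`⊤` if there is no such `n`. The sum over `j` has only finitely many nonzero terms. -/
noncomputable def Tstar {S : Type*} [DecidableEq S] (m ν : S → ℝ) (i : S) (w : ℤ → S) : ℕ∞ :=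
  sInf {t : ℕ∞ | ∃ n : ℕ, t = n ∧
    localTime m w i (Finset.Icc 0 (n : ℤ)) ≤ ∑' j, ν j * localTime m w j (Finset.Icc 0 (n : ℤ))}

/-- The filtration `ℱₙ = σ(X₀, …, Xₙ)`, `n ≥ 0`. It is contained in the filtration
`σ(Xₖ : k ≤ n)`, so stopping times of the former are stopping times of the latter. -/
def forwardFiltration {S Ω : Type*} [MeasurableSpace S] [mΩ : MeasurableSpace Ω]
    (X : ℤ → Ω → S) (hX : ∀ n, Measurable (X n)) : Filtration ℕ mΩ where
  seq n := ⨆ k : ℕ, ⨆ _ : k ≤ n, MeasurableSpace.comap (X k) inferInstance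
  mono' _ _ hab := biSup_mono fun _ hk => le_trans hk hab
  le' _ := iSup₂_le fun k _ => (hX k).comap_le

end TwoSidedChain

/-!
Multiplied by `m i`, the difference `Lⁱ - ∑ⱼ νⱼ Lʲ` becomes an integer-valued walk along the
trajectory: a visit to `i` counts `1`, a visit to `j ≠ i` counts `-c j`, where
`c j = m i / m j * ν j`, and these increments `f` have integral `0` under the stationary measure
`m`. `T_*` is the first time at which the walk is nonpositive.

*Finiteness.* Let `v x d` be the probability that the chain started in `x`, with initial height `d`,
keeps a positive height forever. As `d → ∞` it increases to a bounded harmonic function, which is a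
constant `ℓ` by recurrence. The function `x ↦ ∑_{k ≤ K} v x (k + f x)` is bounded, so its drift
integrates to `0` under `m`. With `V x n = ∑_{k ≤ n} v x k` that drift is
`V x (f x) - (V x (K + f x) - V x K)`, which tends to `V x (f x) - f x * ℓ` as `K → ∞`. Hence
`∫ V x (f x) ∂m = 0`, so `v x (f x) ≤ V x (f x) = 0` for every `x`.

*Unbiasedness.* Under the possibly infinite law of the stationary two-sided chain, shifts preserve
the measure. Let every time `n` with `X_n = i` send a unit mass to the time `n + T_*`, with `T_*`
taken along the trajectory seen from `n`. A time in state `j` receives at most `c j`, since the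
walks stopped there arrive with distinct integer heights in `[1, c j]`. The masses sent and
received, `m i` and `∑ⱼ m j * c j`, agree, so the bound is attained almost everywhere. As
`m j * c j = m i * ν j`, the trajectory seen from `T_*` is the two-sided chain with initial
distribution `ν`.
-/

namespace TwoSidedChain

open Filter
open scoped Topology ENNReal

section Excursion

variable {S : Type*} [MeasurableSpace S]

theorem abs_integral_le {μ : Measure S} [IsFiniteMeasure μ] {φ : S → ℝ} {C : ℝ}
    (hφ : ∀ x, |φ x| ≤ C) : |∫ x, φ x ∂μ| ≤ C * μ.real Set.univ :=
  norm_integral_le_of_norm_le_const (f := φ) (ae_of_all _ hφ)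

theorem abs_integral_kernel_le (κ : Kernel S S) [IsMarkovKernel κ] {φ : S → ℝ} {C : ℝ}
    (hφ : ∀ x, |φ x| ≤ C) (x : S) : |∫ y, φ y ∂κ x| ≤ C := by
  simpa using abs_integral_le (μ := κ x) hφ

variable [DiscreteMeasurableSpace S]

theorem integrable_of_abs_le {μ : Measure S} [IsFiniteMeasure μ] {φ : S → ℝ} {C : ℝ}
    (hφ : ∀ x, |φ x| ≤ C) : Integrable φ μ :=
  .of_bound (Measurable.of_discrete).aestronglyMeasurable C (ae_of_all _ hφ)

theorem integral_comp_measure (κ : Kernel S S) [IsMarkovKernel κ] (μ : Measure S)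
    [IsFiniteMeasure μ] {φ : S → ℝ} {C : ℝ} (hφ : ∀ x, |φ x| ≤ C) :
    ∫ x, φ x ∂(κ ∘ₘ μ) = ∫ x, ∫ y, φ y ∂κ x ∂μ := by
  rw [Measure.comp_eq_comp_const_apply, Kernel.integral_comp (integrable_of_abs_le hφ)]
  rfl

variable (κ : Kernel S S) (i : S)

/-- The law at time `n` of the chain with transition kernel `κ` started in `i`, restricted to the
event that it has not returned to `i` at the times `1, …, n`. -/
noncomputable def excursion : ℕ → Measure S
  | 0 => Measure.dirac i
  | n + 1 => (κ ∘ₘ excursion n).restrict {i}ᶜ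

/-- The probability that the chain with transition kernel `κ` started in `i` returns to `i` for the
first time at time `n + 1`. -/
noncomputable def firstReturn (n : ℕ) : ℝ :=
  (κ ∘ₘ excursion κ i n).real {i}

theorem restrict_compl_add_dirac (μ : Measure S) :
    μ.restrict {i}ᶜ + μ {i} • Measure.dirac i = μ := by
  rw [← Measure.restrict_singleton, add_comm, Measure.restrict_add_restrict_compl (.singleton i)]

theorem excursion_succ_add (n : ℕ) :
    excursion κ i (n + 1) + (κ ∘ₘ excursion κ i n) {i} • Measure.dirac i =
      κ ∘ₘ excursion κ i n :=
  restrict_compl_add_dirac i _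

variable [IsMarkovKernel κ]

instance isFiniteMeasure_excursion (n : ℕ) : IsFiniteMeasure (excursion κ i n) := by
  induction n with
  | zero => exact inferInstanceAs (IsFiniteMeasure (Measure.dirac i))
  | succ n ih => exact inferInstanceAs (IsFiniteMeasure ((κ ∘ₘ excursion κ i n).restrict {i}ᶜ))

theorem integral_excursion_integral_kernel (n : ℕ) {φ : S → ℝ} {C : ℝ} (hφ : ∀ x, |φ x| ≤ C) :
    ∫ x, ∫ y, φ y ∂κ x ∂excursion κ i n =
      ∫ x, φ x ∂excursion κ i (n + 1) + firstReturn κ i n * φ i := by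
  rw [← integral_comp_measure κ _ hφ, ← excursion_succ_add κ i n,
    integral_add_measure (integrable_of_abs_le hφ)
      ((integrable_of_abs_le hφ).smul_measure (measure_ne_top _ _)),
    integral_smul_measure, integral_dirac]
  rfl

theorem sum_integral_excursion_drift (N : ℕ) {φ : S → ℝ} {C : ℝ} (hφ : ∀ x, |φ x| ≤ C) :
    ∑ n ∈ Finset.range N, ∫ x, (∫ y, φ y ∂κ x - φ x) ∂excursion κ i n =
      ∫ x, φ x ∂excursion κ i N - φ i * (1 - ∑ n ∈ Finset.range N, firstReturn κ i n) := by
  induction N with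
  | zero => simp [excursion]
  | succ N ih =>
    rw [Finset.sum_range_succ, ih, Finset.sum_range_succ,
      integral_sub (integrable_of_abs_le (abs_integral_kernel_le κ hφ)) (integrable_of_abs_le hφ),
      integral_excursion_integral_kernel κ i N hφ]
    ring

theorem real_excursion_univ (N : ℕ) :
    (excursion κ i N).real Set.univ = 1 - ∑ n ∈ Finset.range N, firstReturn κ i n := by
  have h := sum_integral_excursion_drift κ i N (φ := fun _ => 1) (C := 1) (by simp)
  simp only [integral_const, probReal_univ, smul_eq_mul, mul_one, sub_self, mul_zero, one_mul,
    Finset.sum_const_zero] at h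
  linarith

variable {κ i}

theorem tendsto_sum_integral_excursion_drift (hrec : HasSum (firstReturn κ i) 1) {φ : S → ℝ}
    {C : ℝ} (hφ : ∀ x, |φ x| ≤ C) :
    Tendsto (fun N => ∑ n ∈ Finset.range N, ∫ x, (∫ y, φ y ∂κ x - φ x) ∂excursion κ i n)
      atTop (𝓝 0) := by
  have hlost : Tendsto (fun N => 1 - ∑ n ∈ Finset.range N, firstReturn κ i n) atTop (𝓝 0) := by
    simpa using hrec.tendsto_sum_nat.const_sub 1
  have hmass : Tendsto (fun N => ∫ x, φ x ∂excursion κ i N) atTop (𝓝 0) := by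
    refine squeeze_zero_norm (fun N => ?_) (by simpa using hlost.const_mul C)
    rw [← real_excursion_univ κ i N]
    exact abs_integral_le hφ
  simpa only [sum_integral_excursion_drift κ i _ hφ, mul_zero, sub_zero] using
    hmass.sub (hlost.const_mul (φ i))

theorem integral_kernel_eq_of_le (hrec : HasSum (firstReturn κ i) 1) {φ : S → ℝ} {C : ℝ}
    (hφ : ∀ x, |φ x| ≤ C) (hsub : ∀ x, φ x ≤ ∫ y, φ y ∂κ x) : ∫ y, φ y ∂κ i = φ i := by
  have hnonneg : ∀ n, 0 ≤ ∫ x, (∫ y, φ y ∂κ x - φ x) ∂excursion κ i n := fun n =>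
    integral_nonneg fun x => sub_nonneg.2 (hsub x)
  have hfirst : ∫ x, (∫ y, φ y ∂κ x - φ x) ∂excursion κ i 0 ≤ 0 := by
    refine ge_of_tendsto (tendsto_sum_integral_excursion_drift hrec hφ)
      (eventually_atTop.2 ⟨1, fun N hN => ?_⟩)
    exact Finset.single_le_sum (f := fun n => ∫ x, (∫ y, φ y ∂κ x - φ x) ∂excursion κ i n)
      (fun n _ => hnonneg n) (Finset.mem_range.2 hN)
  rw [excursion, integral_dirac] at hfirst
  exact le_antisymm (sub_nonpos.1 hfirst) (hsub i)

end Excursion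

section Stationary

variable {S : Type*} [MeasurableSpace S]
  {κ : Kernel S S} {M : Measure S} {i : S}

theorem comp_measure_mono {μ ν : Measure S} (h : μ ≤ ν) : κ ∘ₘ μ ≤ κ ∘ₘ ν := by
  refine Measure.le_iff.2 fun A hA => ?_
  rw [Measure.bind_apply hA κ.aemeasurable, Measure.bind_apply hA κ.aemeasurable]
  exact lintegral_mono' h le_rfl

theorem sum_range_succ_excursion (N : ℕ) :
    ∑ n ∈ Finset.range (N + 1), excursion κ i n =
      (κ ∘ₘ ∑ n ∈ Finset.range N, excursion κ i n).restrict {i}ᶜ + Measure.dirac i := by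
  induction N with
  | zero => simp [excursion]
  | succ N ih =>
    conv_lhs => rw [Finset.sum_range_succ, ih]
    rw [Finset.sum_range_succ _ N, Measure.comp_add, Measure.restrict_add, excursion,
      add_right_comm]

theorem tsum_measure_comp_excursion [IsMarkovKernel κ]
    (hrec : HasSum (firstReturn κ i) 1) :
    ∑' n, (κ ∘ₘ excursion κ i n) {i} = 1 := by
  rw [tsum_congr fun n => (ofReal_measureReal (measure_ne_top _ _)).symm,
    ← ENNReal.ofReal_tsum_of_nonneg (fun n => measureReal_nonneg) hrec.summable]
  exact (congrArg ENNReal.ofReal hrec.tsum_eq).trans ENNReal.ofReal_one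

variable [DiscreteMeasurableSpace S]

theorem smul_sum_range_excursion_le (hM : κ.Invariant M) (N : ℕ) :
    M {i} • ∑ n ∈ Finset.range N, excursion κ i n ≤ M := by
  induction N with
  | zero => simpa using Measure.zero_le M
  | succ N ih =>
    calc M {i} • ∑ n ∈ Finset.range (N + 1), excursion κ i n
      _ = (κ ∘ₘ (M {i} • ∑ n ∈ Finset.range N, excursion κ i n)).restrict {i}ᶜ +
            M {i} • Measure.dirac i := by
          rw [sum_range_succ_excursion, smul_add, Measure.comp_smul, Measure.restrict_smul]
      _ ≤ (κ ∘ₘ M).restrict {i}ᶜ + M {i} • Measure.dirac i := by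
          gcongr
          exact comp_measure_mono ih
      _ = M := by rw [hM.def, restrict_compl_add_dirac]

theorem smul_sum_excursion_le (hM : κ.Invariant M) : M {i} • Measure.sum (excursion κ i) ≤ M := by
  refine Measure.le_iff.2 fun A hA => ?_
  rw [Measure.smul_apply, Measure.sum_apply _ hA, smul_eq_mul, ← ENNReal.tsum_mul_left]
  refine ENNReal.tsum_le_of_sum_range_le fun N => ?_
  simpa [Finset.mul_sum, Measure.finsetSum_apply] using smul_sum_range_excursion_le hM N A

theorem pow_succ_singleton_ne_zero_iff [Countable S] {n : ℕ} {x y : S} :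
    (κ ^ (n + 1)) x {y} ≠ 0 ↔ ∃ z, κ x {z} ≠ 0 ∧ (κ ^ n) z {y} ≠ 0 := by
  have hsum : (κ ^ (n + 1)) x {y} = ∑' z, (κ ^ n) z {y} * κ x {z} := by
    rw [← lintegral_countable']
    exact Kernel.comp_apply' _ _ _ (.singleton y)
  rw [hsum, Ne, ENNReal.tsum_eq_zero, not_forall]
  simp only [mul_eq_zero, not_or, and_comm, Ne]

theorem forall_of_isIrreducible [Countable S] {φ : Measure S} [hirr : κ.IsIrreducible φ]
    {Q : S → Prop} {y : S} (hy : φ {y} ≠ 0) (hQy : Q y)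
    (hQ : ∀ x z, κ x {z} ≠ 0 → Q z → Q x) (x : S) : Q x := by
  obtain ⟨n, hn⟩ := hirr.irreducible (.singleton y) (pos_iff_ne_zero.2 hy) x
  induction n generalizing x with
  | zero =>
    have hxy : x = y := by
      by_contra hxy
      refine hn.ne' ?_
      change Measure.dirac x {y} = 0
      simpa using hxy
    exact hxy ▸ hQy
  | succ n ih =>
    obtain ⟨z, hxz, hzy⟩ := pow_succ_singleton_ne_zero_iff.1 hn.ne'
    exact hQ x z hxz (ih z (pos_iff_ne_zero.2 hzy))

variable [IsMarkovKernel κ]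

theorem invariant_sum_excursion (hrec : HasSum (firstReturn κ i) 1) :
    κ.Invariant (Measure.sum (excursion κ i)) := by
  rw [Kernel.Invariant]
  ext A hA
  have hstep : ∀ n, (κ ∘ₘ excursion κ i n) A =
      excursion κ i (n + 1) A + (κ ∘ₘ excursion κ i n) {i} * Measure.dirac i A := fun n => by
    simpa using (DFunLike.congr_fun (excursion_succ_add κ i n) A).symm
  calc (κ ∘ₘ Measure.sum (excursion κ i)) A
    _ = ∑' n, (κ ∘ₘ excursion κ i n) A := by
        rw [Measure.bind_sum _ _ κ.aemeasurable, Measure.sum_apply _ hA]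
    _ = ∑' n, excursion κ i (n + 1) A + Measure.dirac i A := by
        rw [tsum_congr hstep, ENNReal.tsum_add, ENNReal.tsum_mul_right,
          tsum_measure_comp_excursion hrec, one_mul]
    _ = Measure.sum (excursion κ i) A := by
        rw [Measure.sum_apply _ hA,
          tsum_eq_zero_add' (f := fun n => excursion κ i n A) ENNReal.summable, add_comm]
        rfl

variable [Countable S] [κ.IsIrreducible Measure.count]

theorem eq_of_invariant_of_le {G : Measure S} (hG : κ.Invariant G) (hM : κ.Invariant M)
    (hle : G ≤ M) (hfin : ∀ x, M {x} ≠ ∞) (hi : M {i} = G {i}) : M = G := by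
  have hsum : ∀ {N : Measure S}, κ.Invariant N → ∀ z, N {z} = ∑' x, κ x {z} * N {x} :=
    fun {N} hN z => by
      rw [← lintegral_countable', ← Measure.bind_apply (.singleton z) κ.aemeasurable, hN.def]
  refine Measure.ext_of_singleton fun x => le_antisymm ?_ (hle {x})
  refine forall_of_isIrreducible (κ := κ) (φ := Measure.count) (y := i)
    (Q := fun x => M {x} ≤ G {x}) (by simp) hi.le (fun x z hxz hz => ?_) x
  contrapose! hz
  rw [hsum hG, hsum hM]
  refine ENNReal.tsum_lt_tsum ?_ (fun y => mul_le_mul_right (hle {y}) _)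
    (ENNReal.mul_lt_mul_right hxz (measure_ne_top _ _) hz)
  rw [← hsum hG]
  exact ((hle {z}).trans_lt (hfin z).lt_top).ne

theorem eq_smul_sum_excursion (hrec : HasSum (firstReturn κ i) 1) (hM : κ.Invariant M)
    (hfin : ∀ x, M {x} ≠ ∞) : M = M {i} • Measure.sum (excursion κ i) := by
  refine eq_of_invariant_of_le ?_ hM (smul_sum_excursion_le hM) hfin (i := i) ?_
  · rw [Kernel.Invariant, Measure.comp_smul, invariant_sum_excursion hrec]
  · rw [Measure.smul_apply, Measure.sum_apply _ (.singleton i),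
      tsum_eq_zero_add' (f := fun n => excursion κ i n {i}) ENNReal.summable]
    simp [excursion]

theorem integral_drift_eq_zero (hrec : HasSum (firstReturn κ i) 1) (hM : κ.Invariant M)
    (hfin : ∀ x, M {x} ≠ ∞) {φ : S → ℝ} {C : ℝ} (hφ : ∀ x, |φ x| ≤ C)
    (hint : Integrable (fun x => ∫ y, φ y ∂κ x - φ x) M) :
    ∫ x, (∫ y, φ y ∂κ x - φ x) ∂M = 0 := by
  rw [eq_smul_sum_excursion hrec hM hfin] at hint ⊢
  rcases eq_or_ne (M {i}) 0 with h0 | h0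
  · simp [h0]
  have hsum := hasSum_integral_measure ((integrable_smul_measure h0 (hfin i)).1 hint)
  rw [integral_smul_measure, tendsto_nhds_unique hsum.tendsto_sum_nat
    (tendsto_sum_integral_excursion_drift hrec hφ), smul_zero]

theorem eq_of_harmonic (hrec : ∀ x, HasSum (firstReturn κ x) 1) {φ : S → ℝ} {C : ℝ}
    (hφ : ∀ x, |φ x| ≤ C) (hharm : ∀ x, ∫ y, φ y ∂κ x = φ x) (x y : S) : φ x = φ y := by
  have hmem : ∀ x, MemLp φ 2 (κ x) := fun x =>
    .of_bound (Measurable.of_discrete).aestronglyMeasurable C (ae_of_all _ hφ)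
  have hvar : ∀ x, Var[φ; κ x] = ∫ y, φ y ^ 2 ∂κ x - φ x ^ 2 := fun x => by
    rw [variance_eq_sub (hmem x), hharm x]
    rfl
  have hsq : ∀ x, |φ x ^ 2| ≤ C ^ 2 := fun x => by
    rw [abs_pow]
    exact pow_le_pow_left₀ (abs_nonneg _) (hφ x) 2
  have hvar_zero : ∀ x, Var[φ; κ x] = 0 := fun x => by
    rw [hvar, integral_kernel_eq_of_le (hrec x) hsq
      fun z => sub_nonneg.1 ((variance_nonneg φ (κ z)).trans_eq (hvar z)), sub_self]
  refine forall_of_isIrreducible (κ := κ) (φ := Measure.count) (y := y)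
    (Q := fun x => φ x = φ y) (by simp) rfl (fun x z hxz hz => ?_) x
  have hae := ae_eq_integral_of_variance_eq_zero (hmem x) (hvar_zero x)
  rw [hharm x, ae_iff_of_countable] at hae
  exact (hae z hxz).symm.trans hz

end Stationary

section PathLaw

variable {S : Type*}

/-- The sequence `x, w 0, w 1, …`. -/
def cons (x : S) (w : ℕ → S) : ℕ → S
  | 0 => x
  | n + 1 => w n

/-- The orbit of `x` under the random maps `ω 0, ω 1, …`: the sequence `x, ω 0 x, ω 1 (ω 0 x), …`.
For independent `ω n` such that `ω n x` has law `κ x` it is the chain with transition kernel `κ`. -/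
def orbit : (ℕ → S → S) → S → ℕ → S
  | _, x, 0 => x
  | ω, x, n + 1 => orbit (fun k => ω (k + 1)) (ω 0 x) n

theorem orbit_cons (g : S → S) (ω : ℕ → S → S) (x : S) :
    orbit (cons g ω) x = cons x (orbit ω (g x)) := by
  ext n
  cases n <;> rfl

variable [MeasurableSpace S]

@[fun_prop]
theorem measurable_cons : Measurable fun q : S × (ℕ → S) => cons q.1 q.2 := by
  refine measurable_pi_lambda _ fun n => ?_
  cases n
  · exact measurable_fst
  · exact (measurable_pi_apply _).comp measurable_snd

@[fun_prop]
theorem measurable_cons_right (x : S) : Measurable (cons x) :=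
  measurable_cons.comp measurable_prodMk_left

theorem infinitePi_eq_map_cons (ρ : Measure S) [IsProbabilityMeasure ρ] :
    Measure.infinitePi (fun _ : ℕ => ρ) =
      (ρ.prod (Measure.infinitePi fun _ : ℕ => ρ)).map fun q => cons q.1 q.2 := by
  refine (Measure.eq_infinitePi _ fun s t ht => ?_).symm
  obtain ⟨N, hN⟩ : ∃ N, s ⊆ Finset.range (N + 1) :=
    ⟨s.sup id, fun n hn => Finset.mem_range_succ_iff.2 (Finset.le_sup (f := id) hn)⟩
  let t' : ℕ → Set S := fun n => if n ∈ s then t n else Set.univ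
  have ht' : ∀ n, MeasurableSet (t' n) := fun n => by
    by_cases hn : n ∈ s <;> simp [t', hn, ht]
  have hpre : (fun q : S × (ℕ → S) => cons q.1 q.2) ⁻¹' Set.pi s t =
      t' 0 ×ˢ Set.pi (Finset.range N : Set ℕ) fun n => t' (n + 1) := by
    ext q
    have hmem : ∀ n, cons q.1 q.2 n ∈ t' n ↔ n ∈ s → cons q.1 q.2 n ∈ t n := fun n => by
      by_cases hn : n ∈ s <;> simp [t', hn]
    calc q ∈ (fun q : S × (ℕ → S) => cons q.1 q.2) ⁻¹' Set.pi s t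
      _ ↔ ∀ n < N + 1, cons q.1 q.2 n ∈ t' n := by
          simp only [hmem]
          exact ⟨fun h n _ hn => h n hn, fun h n hn => h n (Finset.mem_range.1 (hN hn)) hn⟩
      _ ↔ _ := by
          rw [Nat.forall_lt_succ_left]
          simp [cons, Set.mem_pi]
  rw [Measure.map_apply measurable_cons (.pi s.countable_toSet fun n _ => ht n), hpre,
    Measure.prod_prod, Measure.infinitePi_pi _ (fun n _ => ht' (n + 1)), mul_comm,
    ← Finset.prod_range_succ' (fun n => ρ (t' n)), ← Finset.prod_subset hN]
  · exact Finset.prod_congr rfl fun n hn => by simp [t', hn]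
  · exact fun n _ hn => by simp [t', hn]

variable [Countable S] [DiscreteMeasurableSpace S]

theorem measurable_orbit : Measurable fun q : (ℕ → S → S) × S => orbit q.1 q.2 := by
  refine measurable_pi_lambda _ fun n => ?_
  induction n with
  | zero => exact measurable_snd
  | succ n ih =>
    have hstep : Measurable fun q : (ℕ → S → S) × S => q.1 0 q.2 :=
      measurable_from_prod_countable_left fun x =>
        (measurable_pi_apply x).comp (measurable_pi_apply 0)
    exact ih.comp ((by fun_prop : Measurable fun q : (ℕ → S → S) × S => fun k => q.1 (k + 1)).prodMk
      hstep)

theorem measurable_orbit_left (x : S) : Measurable fun ω : ℕ → S → S => orbit ω x :=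
  measurable_orbit.comp measurable_prodMk_right

variable (κ : Kernel S S) [IsMarkovKernel κ]

/-- The law of a sequence of independent random maps `S → S` that send each `x` to a point with
law `κ x`. -/
noncomputable def randomMaps : Measure (ℕ → S → S) :=
  Measure.infinitePi fun _ => Measure.infinitePi fun x => κ x

instance : IsProbabilityMeasure (randomMaps κ) :=
  inferInstanceAs (IsProbabilityMeasure (Measure.infinitePi _))

/-- `pathKernel κ x` is the law of the Markov chain with transition kernel `κ` started in `x`. -/
noncomputable def pathKernel : Kernel S (ℕ → S) :=
  Kernel.ofFunOfCountable fun x => (randomMaps κ).map fun ω => orbit ω x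

instance : IsMarkovKernel (pathKernel κ) :=
  ⟨fun x => Measure.isProbabilityMeasure_map (measurable_orbit_left x).aemeasurable⟩

theorem map_orbit_prod (μ : Measure S) :
    (μ.prod (randomMaps κ)).map (fun q => orbit q.2 q.1) = pathKernel κ ∘ₘ μ := by
  have hmeas : Measurable fun q : S × (ℕ → S → S) => orbit q.2 q.1 :=
    measurable_orbit.comp measurable_swap
  ext A hA
  rw [Measure.map_apply hmeas hA, Measure.prod_apply (hmeas hA),
    Measure.bind_apply hA (Kernel.aemeasurable _)]
  exact lintegral_congr fun x => (Measure.map_apply (measurable_orbit_left x) hA).symm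

theorem pathKernel_eq_map_cons (x : S) :
    pathKernel κ x = (pathKernel κ ∘ₘ κ x).map (cons x) := by
  have horbit : Measurable fun q : S × (ℕ → S → S) => orbit q.2 q.1 :=
    measurable_orbit.comp measurable_swap
  have heval : Measurable (Prod.map (fun g : S → S => g x) id : _ → S × (ℕ → S → S)) :=
    (measurable_pi_apply x).prodMap measurable_id
  calc pathKernel κ x
    _ = (((Measure.infinitePi fun x => κ x).prod (randomMaps κ)).map fun q => cons q.1 q.2).map
          fun ω => orbit ω x := by
        rw [randomMaps, ← infinitePi_eq_map_cons]
        rfl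
    _ = ((((Measure.infinitePi fun x => κ x).prod (randomMaps κ)).map
          (Prod.map (fun g => g x) id)).map fun q => orbit q.2 q.1).map (cons x) := by
        rw [Measure.map_map (measurable_orbit_left x) measurable_cons,
          Measure.map_map horbit heval,
          Measure.map_map (measurable_cons_right x) (horbit.comp heval)]
        exact congrArg (Measure.map · _) (funext fun q => orbit_cons _ _ _)
    _ = (pathKernel κ ∘ₘ κ x).map (cons x) := by
        rw [← Measure.map_prod_map _ _ (measurable_pi_apply x) measurable_id, Measure.map_id,
          Measure.infinitePi_map_eval, map_orbit_prod]

end PathLaw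

section PathCylinder

variable {S : Type*} [MeasurableSpace S] [DiscreteMeasurableSpace S]

theorem measurableSet_pi_eq {ι : Type*} [Countable ι] (I : Set ι) (y : ι → S) :
    MeasurableSet {w : ι → S | ∀ k ∈ I, w k = y k} :=
  MeasurableSet.pi I.to_countable fun k _ => .singleton (y k)

theorem measurableSet_cylinder (y : ℕ → S) (n : ℕ) : MeasurableSet (PiNat.cylinder y n) :=
  measurableSet_pi_eq {k | k < n} y

variable [Countable S] (κ : Kernel S S) [IsMarkovKernel κ]

theorem pathKernel_apply_cylinder_succ (x : S) (y : ℕ → S) (n : ℕ) :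
    pathKernel κ x (PiNat.cylinder y (n + 1)) = ({y 0} : Set S).indicator
      (fun x => (pathKernel κ ∘ₘ κ x) (PiNat.cylinder (fun k => y (k + 1)) n)) x := by
  have hpre : cons x ⁻¹' PiNat.cylinder y (n + 1) =
      {_w | x = y 0} ∩ PiNat.cylinder (fun k => y (k + 1)) n := by
    ext w
    exact Nat.forall_lt_succ_left
  rw [pathKernel_eq_map_cons, Measure.map_apply (measurable_cons_right x)
    (measurableSet_cylinder y _), hpre]
  by_cases hx : x = y 0 <;> simp [hx]

theorem comp_pathKernel_cylinder (y : ℕ → S) (n : ℕ) :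
    (pathKernel κ ∘ₘ κ (y 0)) (PiNat.cylinder (fun k => y (k + 1)) n) =
      ∏ k ∈ Finset.range n, κ (y k) {y (k + 1)} := by
  induction n generalizing y with
  | zero => simp
  | succ n ih =>
    have hind : ∀ z, pathKernel κ z (PiNat.cylinder (fun k => y (k + 1)) (n + 1)) =
        ({y 1} : Set S).indicator
          (fun _ => ∏ k ∈ Finset.range n, κ (y (k + 1)) {y (k + 2)}) z := fun z => by
      rw [pathKernel_apply_cylinder_succ]
      refine congrFun (Set.indicator_congr fun z hz => ?_) z
      rw [Set.mem_singleton_iff.1 hz]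
      exact ih fun k => y (k + 1)
    rw [Measure.bind_apply (measurableSet_cylinder _ _) (Kernel.aemeasurable _),
      lintegral_congr hind, lintegral_indicator_const (.singleton _), Finset.prod_range_succ']

end PathCylinder

section TwoSided

variable {S : Type*}

/-- The two-sided trajectory `…, v 1, v 0, u 0, u 1, …` with `u 0` at time `0`. -/
def glue (u v : ℕ → S) : ℤ → S
  | .ofNat n => u n
  | .negSucc n => v n

/-- `shift n w` is the trajectory `w` seen from time `n`. -/
def shift (n : ℤ) (w : ℤ → S) : ℤ → S :=
  fun k => w (k + n)

theorem shift_one_glue_cons (x : S) (u v : ℕ → S) :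
    shift 1 (glue (cons x u) v) = glue u (cons x v) := by
  ext k
  rcases k with n | (_ | n) <;> rfl

/-- The trajectories that agree with `x` on the time window `[-a, b]`. -/
def windowCylinder (a b : ℕ) (x : ℤ → S) : Set (ℤ → S) :=
  {w | ∀ k : ℤ, -(a : ℤ) ≤ k → k ≤ (b : ℤ) → w k = x k}

theorem glue_mem_windowCylinder {a b : ℕ} {x : ℤ → S} {u v : ℕ → S} :
    glue u v ∈ windowCylinder a b x ↔ u ∈ PiNat.cylinder (fun k : ℕ => x k) (b + 1) ∧
      v ∈ PiNat.cylinder (fun k : ℕ => x (-(k + 1 : ℕ))) a := by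
  refine ⟨fun h => ⟨fun k hk => h k (by lia) (by lia), fun k hk => h (.negSucc k) (by lia)
    (by lia)⟩, fun h k ha hb => ?_⟩
  rcases k with n | n
  · exact h.1 n (by lia)
  · exact h.2 n (by lia)

variable [MeasurableSpace S]

@[fun_prop]
theorem measurable_glue : Measurable fun q : (ℕ → S) × (ℕ → S) => glue q.1 q.2 := by
  refine measurable_pi_lambda _ fun k => ?_
  rcases k with n | n
  · exact (measurable_pi_apply n).comp measurable_fst
  · exact (measurable_pi_apply n).comp measurable_snd

@[fun_prop]
theorem measurable_shift (n : ℤ) : Measurable (shift n : (ℤ → S) → ℤ → S) :=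
  measurable_pi_lambda _ fun k => measurable_pi_apply (k + n)

variable [DiscreteMeasurableSpace S]

theorem measurableSet_windowCylinder (a b : ℕ) (x : ℤ → S) :
    MeasurableSet (windowCylinder a b x) := by
  simpa [windowCylinder] using measurableSet_pi_eq (Set.Icc (-(a : ℤ)) b) x

variable [Countable S]

theorem eq_of_windowCylinder {P Q : Measure (ℤ → S)} [IsFiniteMeasure P]
    (h : ∀ (N : ℕ) (x : ℤ → S), P (windowCylinder N N x) = Q (windowCylinder N N x)) : P = Q := by
  have hwindow : ∀ N : ℕ, P.map (Finset.Icc (-(N : ℤ)) N).restrict =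
      Q.map (Finset.Icc (-(N : ℤ)) N).restrict := fun N => by
    refine Measure.ext_of_singleton fun y => ?_
    let x : ℤ → S := fun k => if hk : k ∈ Finset.Icc (-(N : ℤ)) N then y ⟨k, hk⟩ else
      y ⟨0, by simp⟩
    have hpre : (Finset.Icc (-(N : ℤ)) N).restrict (π := fun _ => S) ⁻¹' {y} =
        windowCylinder N N x := by
      ext w
      simp +contextual [funext_iff, windowCylinder, x]
    rw [Measure.map_apply (by fun_prop) (.singleton y), hpre, h,
      Measure.map_apply (by fun_prop) (.singleton y), hpre]
  have hfin : ∀ I : Finset ℤ, Q.map I.restrict = P.map I.restrict := fun I => by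
    obtain ⟨N, hN⟩ : ∃ N : ℕ, I ⊆ Finset.Icc (-(N : ℤ)) N :=
      ⟨I.sup Int.natAbs, fun k hk => by
        have := Finset.le_sup (f := Int.natAbs) hk
        rw [Finset.mem_Icc]
        lia⟩
    have hrestrict := congrArg (Measure.map (Finset.restrict₂ (π := fun _ => S) hN)) (hwindow N)
    rw [Measure.map_map (by fun_prop) (by fun_prop), Measure.map_map (by fun_prop) (by fun_prop),
      Finset.restrict₂_comp_restrict] at hrestrict
    exact hrestrict.symm
  exact IsProjectiveLimit.unique (P := fun I => P.map I.restrict) (fun _ => rfl) hfin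

theorem comp_prod_apply {α β : Type*} [MeasurableSpace α] [MeasurableSpace β] (η : Kernel S α)
    (μ : Measure S) (ν : Measure β) [SFinite ν] {B : Set (α × β)}
    (hB : MeasurableSet B) : ((η ∘ₘ μ).prod ν) B = ∫⁻ y, (η y).prod ν B ∂μ := by
  rw [Measure.comp_eq_sum_of_countable, Measure.prod_sum_left, Measure.sum_apply _ hB,
    lintegral_countable']
  refine tsum_congr fun y => ?_
  rw [Measure.prod_smul_left, Measure.smul_apply, smul_eq_mul, mul_comm]

theorem prod_comp_apply {α β : Type*} [MeasurableSpace α] [MeasurableSpace β] (η : Kernel S β)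
    [IsMarkovKernel η] (μ : Measure α) (ν : Measure S) {B : Set (α × β)}
    (hB : MeasurableSet B) : (μ.prod (η ∘ₘ ν)) B = ∫⁻ y, μ.prod (η y) B ∂ν := by
  rw [Measure.comp_eq_sum_of_countable, Measure.prod_sum_right, Measure.sum_apply _ hB,
    lintegral_countable']
  refine tsum_congr fun y => ?_
  rw [Measure.prod_smul_right, Measure.smul_apply, smul_eq_mul, mul_comm]

variable {κ κ' : Kernel S S}

theorem lintegral_lintegral_eq_of_dual {M : Measure S}
    (hdual : ∀ x y, M {x} * κ x {y} = M {y} * κ' y {x}) (F : S → S → ℝ≥0∞) :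
    ∫⁻ x, ∫⁻ y, F x y ∂κ x ∂M = ∫⁻ y, ∫⁻ x, F x y ∂κ' y ∂M := by
  simp only [lintegral_countable', ← ENNReal.tsum_mul_right]
  rw [ENNReal.tsum_comm]
  refine tsum_congr fun y => tsum_congr fun x => ?_
  rw [mul_assoc, mul_assoc, mul_comm _ (M {x}), mul_comm _ (M {y}), hdual]

variable (κ κ') [IsMarkovKernel κ] [IsMarkovKernel κ']

/-- `twoSidedKernel κ κ' x` is the law of the process with value `x` at time `0` whose future and
past are independent Markov chains with transition kernels `κ` and `κ'`. -/
noncomputable def twoSidedKernel : Kernel S (ℤ → S) :=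
  (pathKernel κ ×ₖ (pathKernel κ' ∘ₖ κ')).map fun q => glue q.1 q.2

instance : IsMarkovKernel (twoSidedKernel κ κ') :=
  Kernel.IsMarkovKernel.map _ measurable_glue

theorem twoSidedKernel_apply (x : S) : twoSidedKernel κ κ' x =
    ((pathKernel κ x).prod (pathKernel κ' ∘ₘ κ' x)).map fun q => glue q.1 q.2 := by
  rw [twoSidedKernel, Kernel.map_apply _ measurable_glue, Kernel.prod_apply, Kernel.comp_apply]

theorem twoSidedKernel_windowCylinder (z : S) (a b : ℕ) (x : ℤ → S) :
    twoSidedKernel κ κ' z (windowCylinder a b x) = ({x 0} : Set S).indicator (fun _ =>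
      (∏ k ∈ Finset.range b, κ (x k) {x (k + 1)}) *
        ∏ k ∈ Finset.range a, κ' (x (-k)) {x (-k - 1)}) z := by
  have hpre : (fun q : (ℕ → S) × (ℕ → S) => glue q.1 q.2) ⁻¹' windowCylinder a b x =
      PiNat.cylinder (fun k : ℕ => x k) (b + 1) ×ˢ
        PiNat.cylinder (fun k : ℕ => x (-(k + 1 : ℕ))) a :=
    Set.ext fun _ => glue_mem_windowCylinder
  rw [twoSidedKernel_apply, Measure.map_apply measurable_glue (measurableSet_windowCylinder a b x),
    hpre, Measure.prod_prod, pathKernel_apply_cylinder_succ]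
  by_cases hz : z = x 0
  · subst hz
    have hfuture := comp_pathKernel_cylinder κ (fun k : ℕ => x k) b
    have hpast := comp_pathKernel_cylinder κ' (fun k : ℕ => x (-k)) a
    rw [Set.indicator_of_mem (by simp), Set.indicator_of_mem (by simp)]
    push_cast at hfuture hpast ⊢
    rw [neg_zero] at hpast
    rw [hfuture, hpast]
    simp only [neg_add']
  · simp [hz]

theorem comp_twoSidedKernel_windowCylinder (μ : Measure S) (a b : ℕ) (x : ℤ → S) :
    (twoSidedKernel κ κ' ∘ₘ μ) (windowCylinder a b x) = μ {x 0} *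
      (∏ k ∈ Finset.range b, κ (x k) {x (k + 1)}) *
        ∏ k ∈ Finset.range a, κ' (x (-k)) {x (-k - 1)} := by
  rw [Measure.bind_apply (measurableSet_windowCylinder a b x) (Kernel.aemeasurable _),
    lintegral_congr fun z => twoSidedKernel_windowCylinder κ κ' z a b x,
    lintegral_indicator_const (.singleton _)]
  ring

theorem map_shift_one_twoSidedKernel (x : S) :
    (twoSidedKernel κ κ' x).map (shift 1) =
      ((pathKernel κ ∘ₘ κ x).prod (pathKernel κ' x)).map fun q => glue q.1 q.2 := by
  have hcons := measurable_cons_right x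
  have hfuture : (pathKernel κ x).prod (pathKernel κ' ∘ₘ κ' x) =
      ((pathKernel κ ∘ₘ κ x).prod (pathKernel κ' ∘ₘ κ' x)).map (Prod.map (cons x) id) := by
    rw [pathKernel_eq_map_cons, ← Measure.map_prod_map _ _ hcons measurable_id, Measure.map_id]
  have hpast : (pathKernel κ ∘ₘ κ x).prod (pathKernel κ' x) =
      ((pathKernel κ ∘ₘ κ x).prod (pathKernel κ' ∘ₘ κ' x)).map (Prod.map id (cons x)) := by
    rw [pathKernel_eq_map_cons κ', ← Measure.map_prod_map _ _ measurable_id hcons, Measure.map_id]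
  calc (twoSidedKernel κ κ' x).map (shift 1)
    _ = ((pathKernel κ ∘ₘ κ x).prod (pathKernel κ' ∘ₘ κ' x)).map
          fun q => shift 1 (glue (cons x q.1) q.2) := by
        rw [twoSidedKernel_apply, hfuture,
          Measure.map_map measurable_glue (hcons.prodMap measurable_id),
          Measure.map_map (measurable_shift 1) (by fun_prop)]
        rfl
    _ = ((pathKernel κ ∘ₘ κ x).prod (pathKernel κ' ∘ₘ κ' x)).map
          fun q => glue q.1 (cons x q.2) := by
        simp only [shift_one_glue_cons]
    _ = ((pathKernel κ ∘ₘ κ x).prod (pathKernel κ' x)).map fun q => glue q.1 q.2 := by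
        rw [hpast, Measure.map_map measurable_glue (measurable_id.prodMap hcons)]
        rfl

variable {κ κ'} {M : Measure S}

theorem measurePreserving_shift_one (hdual : ∀ x y, M {x} * κ x {y} = M {y} * κ' y {x}) :
    MeasurePreserving (shift 1) (twoSidedKernel κ κ' ∘ₘ M) (twoSidedKernel κ κ' ∘ₘ M) := by
  refine ⟨measurable_shift 1, Measure.ext fun A hA => ?_⟩
  have hglue := measurable_glue (S := S) hA
  let F : S → S → ℝ≥0∞ := fun x y =>
    (pathKernel κ y).prod (pathKernel κ' x) ((fun q => glue q.1 q.2) ⁻¹' A)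
  have hfuture : ∀ x, (twoSidedKernel κ κ' x).map (shift 1) A = ∫⁻ y, F x y ∂κ x := fun x => by
    rw [map_shift_one_twoSidedKernel, Measure.map_apply measurable_glue hA,
      comp_prod_apply _ _ _ hglue]
  have hpast : ∀ y, twoSidedKernel κ κ' y A = ∫⁻ x, F x y ∂κ' y := fun y => by
    rw [twoSidedKernel_apply, Measure.map_apply measurable_glue hA, prod_comp_apply _ _ _ hglue]
  rw [Measure.map_comp _ _ (measurable_shift 1), Measure.bind_apply hA (Kernel.aemeasurable _),
    Measure.bind_apply hA (Kernel.aemeasurable _)]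
  simp only [Kernel.map_apply _ (measurable_shift 1), hfuture, hpast]
  exact lintegral_lintegral_eq_of_dual hdual F

theorem measurePreserving_shift (hdual : ∀ x y, M {x} * κ x {y} = M {y} * κ' y {x}) (n : ℕ) :
    MeasurePreserving (shift n) (twoSidedKernel κ κ' ∘ₘ M) (twoSidedKernel κ κ' ∘ₘ M) := by
  induction n with
  | zero =>
    convert MeasurePreserving.id (twoSidedKernel κ κ' ∘ₘ M) using 1
    ext w k
    simp [shift]
  | succ n ih =>
    convert (measurePreserving_shift_one hdual).comp ih using 1
    ext w k
    simp [shift, add_right_comm, add_assoc]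

end TwoSided

section FirstNonposTime

variable {S : Type*} (f : S → ℤ)

/-- The sum of `f` along the trajectory `w` over the times `0, …, n`. -/
def partialSum (w : ℤ → S) (n : ℕ) : ℤ :=
  ∑ k ∈ Finset.range (n + 1), f (w k)

/-- The first time `n` at which `partialSum f w n` is nonpositive, `⊤` if there is none. -/
noncomputable def firstNonposTime (w : ℤ → S) : ℕ∞ :=
  sInf {t : ℕ∞ | ∃ n : ℕ, t = n ∧ partialSum f w n ≤ 0}

variable {f}

theorem firstNonposTime_le_iff {w : ℤ → S} {n : ℕ} :
    firstNonposTime f w ≤ n ↔ ∃ k ≤ n, partialSum f w k ≤ 0 := by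
  rw [← ENat.lt_add_one_iff (ENat.natCast_ne_top n), firstNonposTime, sInf_lt_iff]
  constructor
  · rintro ⟨_, ⟨k, rfl, hk⟩, hkn⟩
    exact ⟨k, by exact_mod_cast ENat.lt_add_one_iff (ENat.natCast_ne_top n) |>.1 hkn, hk⟩
  · rintro ⟨k, hkn, hk⟩
    exact ⟨k, ⟨k, rfl, hk⟩, by exact_mod_cast Nat.lt_succ_of_le hkn⟩

theorem firstNonposTime_eq_top_iff {w : ℤ → S} :
    firstNonposTime f w = ⊤ ↔ ∀ n, 0 < partialSum f w n := by
  simp only [firstNonposTime, sInf_eq_top, ← not_le]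
  exact ⟨fun h n hn => ENat.natCast_ne_top n (h n ⟨n, rfl, hn⟩),
    fun h _ ⟨n, _, hn⟩ => absurd hn (h n)⟩

theorem firstNonposTime_eq_natCast_iff {w : ℤ → S} {n : ℕ} :
    firstNonposTime f w = n ↔ (∀ k < n, 0 < partialSum f w k) ∧ partialSum f w n ≤ 0 := by
  constructor
  · intro h
    have hpos : ∀ k < n, 0 < partialSum f w k := fun k hk => by
      by_contra! hle
      have := firstNonposTime_le_iff.2 ⟨k, le_rfl, hle⟩
      rw [h, Nat.cast_le] at this
      lia
    obtain ⟨k, hkn, hk⟩ := firstNonposTime_le_iff.1 h.le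
    obtain rfl : k = n := hkn.eq_of_not_lt fun hlt => hk.not_gt (hpos k hlt)
    exact ⟨hpos, hk⟩
  · rintro ⟨hpos, hn⟩
    refine (firstNonposTime_le_iff.2 ⟨n, le_rfl, hn⟩).antisymm (le_sInf ?_)
    rintro _ ⟨k, rfl, hk⟩
    exact_mod_cast not_lt.1 fun hkn => hk.not_gt (hpos k hkn)

variable (f) in
/-- The sum of `f` along the trajectory `w` over the times `-n, …, -1`. -/
def pastSum (w : ℤ → S) (n : ℕ) : ℤ :=
  ∑ k ∈ Finset.range n, f (w (k - n))

theorem partialSum_shift_neg (w : ℤ → S) (n : ℕ) :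
    partialSum f (shift (-n) w) n = pastSum f w n + f (w 0) := by
  rw [partialSum, Finset.sum_range_succ, shift, add_neg_cancel]
  rfl

theorem partialSum_shift_neg_add (w : ℤ → S) (n j : ℕ) :
    partialSum f (shift (-(n + j + 1 : ℕ)) w) j + pastSum f w n = pastSum f w (n + j + 1) := by
  have hsplit := Finset.sum_range_add (fun k : ℕ => f (w (k - (n + j + 1 : ℕ)))) (j + 1) n
  rw [show (j + 1) + n = n + j + 1 by ring] at hsplit
  rw [pastSum, pastSum, hsplit]
  refine congrArg₂ (· + ·) rfl (Finset.sum_congr rfl fun k _ => congrArg (f ∘ w) ?_)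
  push_cast
  ring

theorem pastSum_lt_pastSum {w : ℤ → S} {n n' : ℕ} (hn : n < n')
    (hn' : firstNonposTime f (shift (-n') w) = n') : pastSum f w n < pastSum f w n' := by
  obtain ⟨j, rfl⟩ := Nat.exists_eq_add_of_lt hn
  have hpos := (firstNonposTime_eq_natCast_iff.1 hn').1 j (by lia)
  rw [← partialSum_shift_neg_add]
  lia

theorem pastSum_mem_Icc {w : ℤ → S} {n : ℕ} (hstart : 0 < f (w (-n)))
    (hn : firstNonposTime f (shift (-n) w) = n) : pastSum f w n ∈ Set.Icc 1 (-f (w 0)) := by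
  have hle := (firstNonposTime_eq_natCast_iff.1 hn).2
  rw [partialSum_shift_neg] at hle
  obtain _ | n := n
  · rw [Nat.cast_zero, neg_zero] at hstart
    rw [pastSum, Finset.sum_range_zero, zero_add] at hle
    lia
  · have hlt := pastSum_lt_pastSum n.succ_pos hn
    rw [pastSum, Finset.sum_range_zero] at hlt
    exact ⟨hlt, by lia⟩

theorem encard_firstNonposTime_shift_neg_le (w : ℤ → S) :
    {n : ℕ | 0 < f (w (-n)) ∧ firstNonposTime f (shift (-n) w) = n}.encard ≤
      (-f (w 0)).toNat := by
  have hinj : {n : ℕ | 0 < f (w (-n)) ∧ firstNonposTime f (shift (-n) w) = n}.InjOn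
      (pastSum f w) := fun n hn n' hn' heq =>
    le_antisymm (not_lt.1 fun h => (pastSum_lt_pastSum h hn.2).ne' heq)
      (not_lt.1 fun h => (pastSum_lt_pastSum h hn'.2).ne heq)
  calc _ ≤ (Set.Icc 1 (-f (w 0))).encard :=
        Set.encard_le_encard_of_injOn (fun n hn => pastSum_mem_Icc hn.1 hn.2) hinj
    _ = (-f (w 0)).toNat := by
        rw [← Finset.coe_Icc, Set.encard_coe_eq_coe_finsetCard, Int.card_Icc]
        simp

theorem tsum_indicator_firstNonposTime_shift_neg_le (w : ℤ → S) :
    ∑' n : ℕ, {w : ℤ → S | 0 < f (w (-n)) ∧ firstNonposTime f (shift (-n) w) = n}.indicator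
      (1 : (ℤ → S) → ℝ≥0∞) w ≤ ((-f (w 0)).toNat : ℝ≥0∞) := by
  calc _ = ∑' n : ℕ, {n : ℕ | 0 < f (w (-n)) ∧ firstNonposTime f (shift (-n) w) = n}.indicator
        (1 : ℕ → ℝ≥0∞) n := by
        simp [Set.indicator_apply]
    _ = {n : ℕ | 0 < f (w (-n)) ∧ firstNonposTime f (shift (-n) w) = n}.encard := by
        rw [← tsum_subtype, ← ENNReal.tsum_set_one]
        rfl
    _ ≤ _ := by exact_mod_cast ENat.toENNReal_le.2 (encard_firstNonposTime_shift_neg_le w)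

variable [MeasurableSpace S] [DiscreteMeasurableSpace S]

theorem measurable_partialSum {Ω : Type*} [MeasurableSpace Ω] {X : ℤ → Ω → S} {n : ℕ}
    (hX : ∀ k : ℕ, k ≤ n → Measurable (X k)) :
    Measurable fun ω => partialSum f (fun k => X k ω) n :=
  Finset.measurable_fun_sum _ fun k hk =>
    Measurable.of_discrete.comp (hX k (Finset.mem_range_succ_iff.1 hk))

theorem measurableSet_firstNonposTime_le {Ω : Type*} [MeasurableSpace Ω] {X : ℤ → Ω → S} {n : ℕ}
    (hX : ∀ k : ℕ, k ≤ n → Measurable (X k)) :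
    MeasurableSet {ω | firstNonposTime f (fun k => X k ω) ≤ n} := by
  have hunion : {ω | firstNonposTime f (fun k => X k ω) ≤ n} =
      ⋃ k : ℕ, ⋃ _ : k ≤ n, {ω | partialSum f (fun l => X l ω) k ≤ 0} := by
    ext
    simp [firstNonposTime_le_iff]
  rw [hunion]
  exact .iUnion fun k => .iUnion fun hk =>
    measurable_partialSum (fun l hl => hX l (hl.trans hk)) measurableSet_Iic

variable (f) in
@[fun_prop]
theorem measurable_firstNonposTime : Measurable (firstNonposTime f) := by
  refine ENat.measurable_iff.2 fun n => ?_
  have hsum : ∀ k, Measurable fun w : ℤ → S => partialSum f w k := fun k =>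
    measurable_partialSum fun l _ => measurable_pi_apply (l : ℤ)
  have hpre : firstNonposTime f ⁻¹' {(n : ℕ∞)} =
      (⋂ k : ℕ, ⋂ _ : k < n, {w | 0 < partialSum f w k}) ∩ {w | partialSum f w n ≤ 0} := by
    ext
    simp [firstNonposTime_eq_natCast_iff]
  rw [hpre]
  exact (MeasurableSet.iInter fun k => .iInter fun _ => hsum k measurableSet_Ioi).inter
    (hsum n measurableSet_Iic)

variable (f) in
/-- The trajectory `w` with its origin moved to the time `firstNonposTime f w`; it is not moved if
that time is infinite. -/
noncomputable def shiftFirstNonpos (w : ℤ → S) : ℤ → S :=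
  shift (firstNonposTime f w).toNat w

variable (f) in
@[fun_prop]
theorem measurable_shiftFirstNonpos : Measurable (shiftFirstNonpos f) := by
  have hshift : Measurable fun q : ℕ × (ℤ → S) => shift (q.1 : ℤ) q.2 :=
    measurable_from_prod_countable_right fun n => measurable_shift n
  exact hshift.comp (by fun_prop : Measurable fun w => ((firstNonposTime f w).toNat, w))

/-- Mass transport: each trajectory with `0 < f (w 0)` sends a unit mass to the time
`firstNonposTime f w`, and time `0` receives at most `(-f (w 0)).toNat`. -/
theorem map_shiftFirstNonpos_le {Q : Measure (ℤ → S)}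
    (hQ : ∀ n : ℕ, MeasurePreserving (shift n) Q Q) :
    (Q.restrict {w | 0 < f (w 0) ∧ firstNonposTime f w ≠ ⊤}).map (shiftFirstNonpos f) ≤
      Q.withDensity fun w => ((-f (w 0)).toNat : ℝ≥0∞) := by
  have hf : ∀ n : ℤ, Measurable fun w : ℤ → S => f (w n) := fun n =>
    Measurable.of_discrete.comp (measurable_pi_apply n)
  refine Measure.le_iff.2 fun A hA => ?_
  let C : ℕ → Set (ℤ → S) := fun n =>
    A ∩ {w | 0 < f (w (-n)) ∧ firstNonposTime f (shift (-n) w) = n}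
  have hC : ∀ n, MeasurableSet (C n) := fun n =>
    hA.inter ((hf _ measurableSet_Ioi).inter
      ((measurable_firstNonposTime f).comp (measurable_shift _) (measurableSet_singleton _)))
  have hsplit : shiftFirstNonpos f ⁻¹' A ∩ {w | 0 < f (w 0) ∧ firstNonposTime f w ≠ ⊤} ⊆
      ⋃ n : ℕ, shift n ⁻¹' C n := by
    rintro w ⟨hwA, hw, htop⟩
    obtain ⟨n, hn⟩ := ENat.ne_top_iff_exists.1 htop
    have hback : shift (-n) (shift n w) = w := by
      ext k
      simp [shift]
    refine Set.mem_iUnion.2 ⟨n, ?_, ?_, ?_⟩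
    · simpa [shiftFirstNonpos, ← hn] using hwA
    · simpa [shift] using hw
    · rw [hback, hn]
  calc (Q.restrict {w | 0 < f (w 0) ∧ firstNonposTime f w ≠ ⊤}).map (shiftFirstNonpos f) A
    _ = Q (shiftFirstNonpos f ⁻¹' A ∩ {w | 0 < f (w 0) ∧ firstNonposTime f w ≠ ⊤}) := by
        rw [Measure.map_apply (by fun_prop) hA,
          Measure.restrict_apply (measurable_shiftFirstNonpos f hA)]
    _ ≤ ∑' n : ℕ, Q (shift n ⁻¹' C n) := (measure_mono hsplit).trans (measure_iUnion_le _)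
    _ = ∫⁻ w, ∑' n : ℕ, (C n).indicator 1 w ∂Q := by
        rw [lintegral_tsum fun n => (measurable_one.indicator (hC n)).aemeasurable]
        exact tsum_congr fun n => by
          rw [(hQ n).measure_preimage (hC n).nullMeasurableSet, lintegral_indicator_one (hC n)]
    _ ≤ ∫⁻ w, A.indicator (fun w => ((-f (w 0)).toNat : ℝ≥0∞)) w ∂Q := by
        refine lintegral_mono fun w => ?_
        simp only [C, ← Set.indicator_indicator]
        by_cases hw : w ∈ A
        · simpa [hw] using tsum_indicator_firstNonposTime_shift_neg_le w
        · simp [hw]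
    _ = _ := by rw [lintegral_indicator hA, withDensity_apply _ hA]

theorem map_shiftFirstNonpos {Q : Measure (ℤ → S)}
    (hQ : ∀ n : ℕ, MeasurePreserving (shift n) Q Q)
    (htop : ∀ᵐ w ∂Q.restrict {w | 0 < f (w 0)}, firstNonposTime f w ≠ ⊤)
    (hfin : Q {w | 0 < f (w 0)} ≠ ∞)
    (hmass : ∫⁻ w, ((-f (w 0)).toNat : ℝ≥0∞) ∂Q = Q {w | 0 < f (w 0)}) :
    (Q.restrict {w | 0 < f (w 0)}).map (shiftFirstNonpos f) =
      Q.withDensity fun w => ((-f (w 0)).toNat : ℝ≥0∞) := by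
  have hpos : MeasurableSet {w : ℤ → S | 0 < f (w 0)} :=
    (Measurable.of_discrete.comp (measurable_pi_apply 0) : Measurable fun w : ℤ → S => f (w 0))
      measurableSet_Ioi
  have hrestrict : Q.restrict {w | 0 < f (w 0) ∧ firstNonposTime f w ≠ ⊤} =
      Q.restrict {w | 0 < f (w 0)} := by
    rw [← Measure.restrict_eq_self_of_ae_mem (s := {w | firstNonposTime f w ≠ ⊤}) htop,
      Measure.restrict_restrict' hpos, Set.inter_comm]
    rfl
  have hle := map_shiftFirstNonpos_le (f := f) hQ
  rw [hrestrict] at hle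
  have : IsFiniteMeasure (Q.restrict {w | 0 < f (w 0)}) := isFiniteMeasure_restrict.2 hfin
  refine Measure.eq_of_le_of_measure_univ_eq hle ?_
  rw [Measure.map_apply (by fun_prop) .univ, Set.preimage_univ, Measure.restrict_apply_univ,
    withDensity_apply _ .univ, Measure.restrict_univ, hmass]

end FirstNonposTime

section Survival

variable {S : Type*} {f : S → ℤ}

variable (f) in
/-- The paths along which the initial height `d`, increased by `f` at every step, stays
positive forever. -/
def survivalSet (d : ℤ) : Set (ℕ → S) :=
  {w | ∀ n, 0 < d + ∑ k ∈ Finset.range n, f (w (k + 1))}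

theorem cons_mem_survivalSet_iff {x : S} {w : ℕ → S} {d : ℤ} :
    cons x w ∈ survivalSet f d ↔ ∀ n, 0 < d + ∑ k ∈ Finset.range n, f (w k) :=
  Iff.rfl

theorem cons_mem_survivalSet_add_iff {x : S} {w : ℕ → S} {d : ℤ} (hd : 0 < d) :
    cons x w ∈ survivalSet f d ↔ w ∈ survivalSet f (d + f (w 0)) := by
  rw [cons_mem_survivalSet_iff, ← Nat.and_forall_add_one]
  simp only [Finset.sum_range_zero, add_zero, hd, true_and, Finset.sum_range_succ', survivalSet,
    Set.mem_ofPred_eq]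
  exact forall_congr' fun n => by rw [add_assoc, add_comm (f (w 0))]

theorem survivalSet_mono {d d' : ℤ} (h : d ≤ d') : survivalSet f d ⊆ survivalSet f d' :=
  fun _ hw n => (hw n).trans_le (by lia)

theorem survivalSet_of_nonpos {d : ℤ} (hd : d ≤ 0) : survivalSet f d = ∅ :=
  Set.eq_empty_of_forall_notMem fun _ hw => hd.not_gt (by simpa using hw 0)

variable [MeasurableSpace S] [DiscreteMeasurableSpace S]

theorem measurableSet_survivalSet (d : ℤ) : MeasurableSet (survivalSet f d) := by
  have hsum : ∀ n, Measurable fun w : ℕ → S => d + ∑ k ∈ Finset.range n, f (w (k + 1)) :=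
    fun n => (Finset.measurable_fun_sum _ fun k _ =>
      Measurable.of_discrete.comp (measurable_pi_apply (k + 1))).const_add d
  rw [survivalSet, Set.ofPred_forall]
  exact .iInter fun n => hsum n measurableSet_Ioi

variable [Countable S] (κ : Kernel S S)

variable (f) in
/-- The probability that the Markov chain started in `x` stays in `survivalSet f d`. -/
noncomputable def survival (x : S) (d : ℤ) : ℝ :=
  (pathKernel κ x).real (survivalSet f d)

theorem survival_nonneg (x : S) (d : ℤ) : 0 ≤ survival f κ x d := measureReal_nonneg

theorem survival_of_nonpos (x : S) {d : ℤ} (hd : d ≤ 0) : survival f κ x d = 0 := by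
  simp [survival, survivalSet_of_nonpos hd]

variable (f) in
/-- A primitive of `survival f κ x`: the sum of its values at the integers from `1` to `n`. -/
noncomputable def survivalSum (x : S) (n : ℤ) : ℝ :=
  ∑ k ∈ Finset.range n.toNat, survival f κ x (k + 1)

theorem survivalSum_add_one_sub (x : S) (n : ℤ) :
    survivalSum f κ x (n + 1) - survivalSum f κ x n = survival f κ x (n + 1) := by
  rcases le_or_gt 0 n with hn | hn
  · simp [survivalSum, Finset.sum_range_succ, Int.toNat_add hn, hn]
  · rw [survival_of_nonpos κ x (by lia), survivalSum, survivalSum, Int.toNat_of_nonpos (by lia),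
      Int.toNat_of_nonpos (by lia), sub_self]

theorem survivalSum_nonneg (x : S) (n : ℤ) : 0 ≤ survivalSum f κ x n :=
  Finset.sum_nonneg fun _ _ => survival_nonneg κ x _

theorem survival_le_survivalSum (x : S) (n : ℤ) : survival f κ x n ≤ survivalSum f κ x n := by
  have := survivalSum_add_one_sub (f := f) κ x (n - 1)
  rw [sub_add_cancel] at this
  linarith [survivalSum_nonneg (f := f) κ x (n - 1)]

theorem tendsto_survivalSum_add_sub {x : S} {v : ℝ}
    (hv : Tendsto (survival f κ x) atTop (𝓝 v)) (n : ℤ) :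
    Tendsto (fun m => survivalSum f κ x (m + n) - survivalSum f κ x m) atTop (𝓝 (n * v)) := by
  have hstep : ∀ n : ℤ, Tendsto
      (fun m => survivalSum f κ x (m + (n + 1)) - survivalSum f κ x (m + n)) atTop (𝓝 v) :=
    fun n => by
      simp only [← add_assoc, survivalSum_add_one_sub]
      exact hv.comp (tendsto_atTop_add_const_right _ 1
        (tendsto_atTop_add_const_right _ n tendsto_id))
  induction n with
  | zero => simp
  | succ n ih =>
    push_cast
    rw [add_one_mul]
    exact (ih.add (hstep n)).congr fun m => by ring
  | pred n ih =>
    have hlast := hstep (-n - 1)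
    rw [sub_add_cancel] at hlast
    push_cast at ih ⊢
    rw [sub_one_mul]
    exact (ih.sub hlast).congr fun m => by ring

theorem sum_survival_eq (x : S) (d : ℤ) (K : ℕ) :
    ∑ k ∈ Finset.range K, survival f κ x (k + 1 + d) =
      survivalSum f κ x (K + d) - survivalSum f κ x d := by
  induction K with
  | zero => simp
  | succ K ih =>
    rw [Finset.sum_range_succ, ih, Nat.cast_succ, add_right_comm, ← survivalSum_add_one_sub]
    ring

variable [IsMarkovKernel κ]

theorem ae_pathKernel_apply_zero (x : S) : ∀ᵐ w ∂pathKernel κ x, w 0 = x := by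
  rw [pathKernel_eq_map_cons, ae_map_iff (measurable_cons_right x).aemeasurable
    (measurableSet_eq_fun (by fun_prop) (by fun_prop))]
  exact ae_of_all _ fun w => rfl

theorem survival_le_one (x : S) (d : ℤ) : survival f κ x d ≤ 1 := measureReal_le_one

theorem abs_survival_le_one (x : S) (d : ℤ) : |survival f κ x d| ≤ 1 :=
  abs_le.2 ⟨by linarith [survival_nonneg (f := f) κ x d], survival_le_one κ x d⟩

theorem survival_mono (x : S) : Monotone (survival f κ x) := fun _ _ h =>
  measureReal_mono (survivalSet_mono h)

theorem integral_survival_add (x : S) {d : ℤ} (hd : 0 < d) :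
    ∫ y, survival f κ y (d + f y) ∂κ x = survival f κ x d := by
  have hae : ∀ y, pathKernel κ y (cons x ⁻¹' survivalSet f d) =
      pathKernel κ y (survivalSet f (d + f y)) := fun y => measure_congr <| by
    filter_upwards [ae_pathKernel_apply_zero κ y] with w hw
    exact propext <| by rw [← hw]; exact cons_mem_survivalSet_add_iff hd
  have hmeas := measurable_cons_right x (measurableSet_survivalSet (f := f) d)
  rw [survival, pathKernel_eq_map_cons, map_measureReal_apply (measurable_cons_right x)
    (measurableSet_survivalSet d), measureReal_def, Measure.bind_apply hmeas
    (Kernel.aemeasurable _), lintegral_congr hae]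
  exact integral_toReal Measurable.of_discrete.aemeasurable
    (ae_of_all _ fun y => measure_lt_top _ _)

theorem pathKernel_forall_pos (x : S) : (pathKernel κ x).real
    {w | ∀ n, 0 < ∑ k ∈ Finset.range (n + 1), f (w k)} = survival f κ x (f x) := by
  refine measureReal_congr ?_
  filter_upwards [ae_pathKernel_apply_zero κ x] with w hw
  refine propext (forall_congr' fun n => ?_)
  rw [Finset.sum_range_succ', hw, add_comm]

theorem exists_tendsto_survival (hrec : ∀ x, HasSum (firstReturn κ x) 1)
    [κ.IsIrreducible Measure.count] :
    ∃ v : ℝ, ∀ x, Tendsto (survival f κ x) atTop (𝓝 v) := by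
  let v : S → ℝ := fun x => ⨆ d, survival f κ x d
  have hlim : ∀ x, Tendsto (survival f κ x) atTop (𝓝 (v x)) := fun x =>
    tendsto_atTop_ciSup (survival_mono κ x) ⟨1, by rintro _ ⟨d, rfl⟩; exact survival_le_one κ x d⟩
  have hbound : ∀ x, |v x| ≤ 1 := fun x =>
    le_of_tendsto (hlim x).abs (.of_forall (abs_survival_le_one κ x))
  have hharm : ∀ x, ∫ y, v y ∂κ x = v x := fun x => by
    have hint : Tendsto (fun d => ∫ y, survival f κ y (d + f y) ∂κ x) atTop
        (𝓝 (∫ y, v y ∂κ x)) :=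
      tendsto_integral_filter_of_dominated_convergence (fun _ => 1)
        (.of_forall fun _ => Measurable.of_discrete.aestronglyMeasurable)
        (.of_forall fun _ => ae_of_all _ fun _ => abs_survival_le_one κ _ _)
        (integrable_const 1)
        (ae_of_all _ fun y => (hlim y).comp (tendsto_atTop_add_const_right _ _ tendsto_id))
    refine tendsto_nhds_unique hint ((hlim x).congr' ?_)
    filter_upwards [eventually_gt_atTop 0] with d hd
    exact (integral_survival_add κ x hd).symm
  rcases isEmpty_or_nonempty S with h | ⟨⟨y⟩⟩
  · exact ⟨0, h.elim⟩
  · exact ⟨v y, fun x => eq_of_harmonic hrec hbound hharm x y ▸ hlim x⟩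

theorem abs_survivalSum_add_sub_le (x : S) (m n : ℤ) :
    |survivalSum f κ x (m + n) - survivalSum f κ x m| ≤ |(n : ℝ)| := by
  have hstep := survivalSum_add_one_sub (f := f) κ x
  have hone := fun d => survival_le_one (f := f) κ x d
  have hzero := fun d => survival_nonneg (f := f) κ x d
  induction n with
  | zero => simp
  | succ n ih =>
    rw [abs_le, Int.cast_natCast, Nat.abs_cast] at ih
    rw [← add_assoc, abs_le]
    push_cast
    rw [abs_of_nonneg (by positivity)]
    constructor <;> linarith [hstep (m + n), hone (m + n + 1), hzero (m + n + 1)]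
  | pred n ih =>
    rw [abs_le, Int.cast_neg, abs_neg, Int.cast_natCast, Nat.abs_cast] at ih
    have hlast := hstep (m + (-n - 1))
    rw [add_assoc, sub_add_cancel] at hlast
    rw [abs_le, abs_of_nonpos (by push_cast; linarith [n.cast_nonneg (α := ℝ)])]
    push_cast
    constructor <;> linarith [hone (m + -n), hzero (m + -n)]

theorem integral_sum_survival (x : S) (K : ℕ) :
    ∫ y, ∑ k ∈ Finset.range K, survival f κ y (k + 1 + f y) ∂κ x = survivalSum f κ x K := by
  rw [integral_finsetSum _ fun k _ => integrable_of_abs_le fun y => abs_survival_le_one κ y _]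
  simp only [survivalSum, Int.toNat_natCast]
  exact Finset.sum_congr rfl fun k _ => integral_survival_add κ x (by lia)

theorem abs_survivalSum_le (x : S) (n : ℤ) : |survivalSum f κ x n| ≤ |(n : ℝ)| := by
  simpa [survivalSum] using abs_survivalSum_add_sub_le (f := f) κ x 0 n

variable {κ}

theorem abs_drift_survivalSum_le (x : S) (K : ℤ) :
    |survivalSum f κ x (f x) - (survivalSum f κ x (K + f x) - survivalSum f κ x K)| ≤
      2 * |(f x : ℝ)| := by
  linarith [abs_sub (survivalSum f κ x (f x)) (survivalSum f κ x (K + f x) - survivalSum f κ x K),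
    abs_survivalSum_le (f := f) κ x (f x),
    abs_survivalSum_add_sub_le (f := f) κ x K (f x)]

variable {M : Measure S}

theorem integrable_survivalSum (hf : Integrable (fun x => (f x : ℝ)) M) :
    Integrable (fun x => survivalSum f κ x (f x)) M :=
  hf.abs.mono' Measurable.of_discrete.aestronglyMeasurable
    (ae_of_all _ fun x => abs_survivalSum_le κ x (f x))

variable [κ.IsIrreducible Measure.count]

theorem integral_survivalSum_add_sub_eq_zero {i : S} (hrec : HasSum (firstReturn κ i) 1)
    (hM : κ.Invariant M) (hfin : ∀ x, M {x} ≠ ∞) (hf : Integrable (fun x => (f x : ℝ)) M)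
    (K : ℕ) : ∫ x, (survivalSum f κ x (f x) -
      (survivalSum f κ x (K + f x) - survivalSum f κ x K)) ∂M = 0 := by
  let φ : S → ℝ := fun x => ∑ k ∈ Finset.range K, survival f κ x (k + 1 + f x)
  have hφ : ∀ x, |φ x| ≤ K := fun x => by
    simp only [φ]
    rw [sum_survival_eq, add_comm]
    simpa using abs_survivalSum_add_sub_le κ x (f x) K
  have hdrift : ∀ x, ∫ y, φ y ∂κ x - φ x = survivalSum f κ x (f x) -
      (survivalSum f κ x (K + f x) - survivalSum f κ x K) := fun x => by
    simp only [φ]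
    rw [integral_sum_survival, sum_survival_eq]
    ring
  simp only [← hdrift]
  refine integral_drift_eq_zero hrec hM hfin hφ ?_
  simp only [hdrift]
  exact (hf.abs.const_mul 2).mono' Measurable.of_discrete.aestronglyMeasurable
    (ae_of_all _ fun x => abs_drift_survivalSum_le x K)

theorem integral_survivalSum_eq_zero (hrec : ∀ x, HasSum (firstReturn κ x) 1)
    (hM : κ.Invariant M) (hfin : ∀ x, M {x} ≠ ∞)
    (hf : Integrable (fun x => (f x : ℝ)) M) (hf0 : ∫ x, (f x : ℝ) ∂M = 0) :
    ∫ x, survivalSum f κ x (f x) ∂M = 0 := by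
  obtain ⟨v, hv⟩ := exists_tendsto_survival (f := f) κ hrec
  rcases isEmpty_or_nonempty S with h | ⟨⟨i⟩⟩
  · simp [Measure.eq_zero_of_isEmpty M]
  have hlim : Tendsto (fun K : ℕ => ∫ x, (survivalSum f κ x (f x) -
      (survivalSum f κ x (K + f x) - survivalSum f κ x K)) ∂M) atTop
      (𝓝 (∫ x, (survivalSum f κ x (f x) - f x * v) ∂M)) :=
    tendsto_integral_of_dominated_convergence (fun x => 2 * |(f x : ℝ)|)
      (fun _ => Measurable.of_discrete.aestronglyMeasurable) (hf.abs.const_mul 2)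
      (fun K => ae_of_all _ fun x => abs_drift_survivalSum_le x K)
      (ae_of_all _ fun x => tendsto_const_nhds.sub
        ((tendsto_survivalSum_add_sub κ (hv x) (f x)).comp tendsto_natCast_atTop_atTop))
  have hzero := tendsto_nhds_unique hlim (tendsto_const_nhds.congr fun K =>
    (integral_survivalSum_add_sub_eq_zero (hrec i) hM hfin hf K).symm)
  rwa [integral_sub (integrable_survivalSum hf) (hf.mul_const v), integral_mul_const, hf0,
    zero_mul, sub_zero] at hzero

theorem survival_eq_zero (hrec : ∀ x, HasSum (firstReturn κ x) 1)
    (hM : κ.Invariant M) (hfin : ∀ x, M {x} ≠ ∞)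
    (hf : Integrable (fun x => (f x : ℝ)) M) (hf0 : ∫ x, (f x : ℝ) ∂M = 0) {x : S}
    (hx : M {x} ≠ 0) : survival f κ x (f x) = 0 := by
  have hae := (integral_eq_zero_iff_of_nonneg (fun x => survivalSum_nonneg κ x (f x))
    (integrable_survivalSum hf)).1 (integral_survivalSum_eq_zero hrec hM hfin hf hf0)
  have hsum : survivalSum f κ x (f x) = 0 := by
    by_contra hne
    exact hx (measure_mono_null (Set.singleton_subset_iff.2 hne) hae)
  exact ((survival_le_survivalSum κ x (f x)).trans_eq hsum).antisymm (survival_nonneg κ x (f x))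

end Survival

section Embedding

variable {S : Type*} [MeasurableSpace S] [DiscreteMeasurableSpace S] {f : S → ℤ} {M : Measure S}

theorem lintegral_toNat_neg_eq (hf : Integrable (fun x => (f x : ℝ)) M)
    (hf0 : ∫ x, (f x : ℝ) ∂M = 0) (hf1 : ∀ x, f x ≤ 1) :
    ∫⁻ x, ((-f x).toNat : ℝ≥0∞) ∂M = M {x | 0 < f x} := by
  have hpos : ∀ x, ENNReal.ofReal (f x) = {x | 0 < f x}.indicator 1 x := fun x => by
    by_cases hx : 0 < f x
    · rw [Set.indicator_of_mem (Set.mem_ofPred_eq ▸ hx), show f x = 1 by grind]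
      simp
    · simp [hx, not_lt.1 hx]
  have hneg : ∀ x, ENNReal.ofReal (-(f x : ℝ)) = (-f x).toNat := fun x => by
    rw [← ENNReal.toReal_eq_toReal_iff' ENNReal.ofReal_ne_top (ENNReal.natCast_ne_top _),
      ENNReal.toReal_ofReal', ENNReal.toReal_natCast, ← Int.cast_natCast, Int.toNat_eq_max]
    push_cast
    rfl
  have hfpos : ∫⁻ x, ENNReal.ofReal (f x) ∂M ≠ ∞ := hf.lintegral_lt_top.ne
  have hfneg : ∫⁻ x, ENNReal.ofReal (-(f x : ℝ)) ∂M ≠ ∞ := hf.neg.lintegral_lt_top.ne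
  rw [integral_eq_lintegral_pos_part_sub_lintegral_neg_part hf, sub_eq_zero,
    ENNReal.toReal_eq_toReal_iff' hfpos hfneg] at hf0
  rw [← lintegral_indicator_one .of_discrete, ← lintegral_congr hpos, hf0, lintegral_congr hneg]

variable [Countable S] (κ κ' : Kernel S S) [IsMarkovKernel κ] [IsMarkovKernel κ']

theorem ae_twoSidedKernel_apply_zero (x : S) : ∀ᵐ w ∂twoSidedKernel κ κ' x, w 0 = x := by
  rw [twoSidedKernel_apply, ae_map_iff measurable_glue.aemeasurable
    (measurableSet_eq_fun (by fun_prop) (by fun_prop))]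
  exact Measure.quasiMeasurePreserving_fst.ae (ae_pathKernel_apply_zero κ x)

theorem withDensity_comp_twoSidedKernel (g : S → ℝ≥0∞) :
    (twoSidedKernel κ κ' ∘ₘ M).withDensity (fun w => g (w 0)) =
      twoSidedKernel κ κ' ∘ₘ M.withDensity g := by
  have hg : Measurable fun w : ℤ → S => g (w 0) :=
    Measurable.of_discrete.comp (measurable_pi_apply 0)
  refine Measure.ext fun A hA => ?_
  rw [withDensity_apply _ hA, ← lintegral_indicator hA,
    Measure.lintegral_bind (Kernel.aemeasurable _) (hg.indicator hA).aemeasurable,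
    Measure.bind_apply hA (Kernel.aemeasurable _),
    lintegral_withDensity_eq_lintegral_mul _ .of_discrete .of_discrete]
  refine lintegral_congr fun x => ?_
  have hae : (A.indicator fun w => g (w 0)) =ᵐ[twoSidedKernel κ κ' x] A.indicator fun _ => g x := by
    filter_upwards [ae_twoSidedKernel_apply_zero κ κ' x] with w hw
    rw [← hw]
    rfl
  rw [lintegral_congr_ae hae, lintegral_indicator_const hA]
  rfl

theorem restrict_comp_twoSidedKernel (B : Set S) :
    (twoSidedKernel κ κ' ∘ₘ M).restrict {w | w 0 ∈ B} =
      twoSidedKernel κ κ' ∘ₘ M.restrict B := by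
  have hB : MeasurableSet {w : ℤ → S | w 0 ∈ B} := measurable_pi_apply 0 .of_discrete
  rw [← withDensity_indicator_one hB, ← withDensity_indicator_one (s := B) .of_discrete,
    ← withDensity_comp_twoSidedKernel]
  rfl

variable {κ κ'}

theorem ae_firstNonposTime_ne_top {x : S} (hx : survival f κ x (f x) = 0) :
    ∀ᵐ w ∂twoSidedKernel κ κ' x, firstNonposTime f w ≠ ⊤ := by
  have hmeas : MeasurableSet {w | firstNonposTime f w ≠ ⊤} :=
    measurable_firstNonposTime f (measurableSet_singleton ⊤).compl
  rw [twoSidedKernel_apply, ae_map_iff measurable_glue.aemeasurable hmeas]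
  rw [← pathKernel_forall_pos, measureReal_eq_zero_iff] at hx
  filter_upwards [Measure.quasiMeasurePreserving_fst.ae (measure_eq_zero_iff_ae_notMem.1 hx)]
    with q hq
  rwa [Ne, firstNonposTime_eq_top_iff]

theorem map_shiftFirstNonpos_comp_twoSidedKernel [κ.IsIrreducible Measure.count]
    (hrec : ∀ x, HasSum (firstReturn κ x) 1) (hM : κ.Invariant M) (hfin : ∀ x, M {x} ≠ ∞)
    (hdual : ∀ x y, M {x} * κ x {y} = M {y} * κ' y {x})
    (hf : Integrable (fun x => (f x : ℝ)) M) (hf0 : ∫ x, (f x : ℝ) ∂M = 0)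
    (hf1 : ∀ x, f x ≤ 1) :
    (twoSidedKernel κ κ' ∘ₘ M.restrict {x | 0 < f x}).map (shiftFirstNonpos f) =
      twoSidedKernel κ κ' ∘ₘ M.withDensity fun x => ((-f x).toNat : ℝ≥0∞) := by
  have hrestrict := restrict_comp_twoSidedKernel (M := M) κ κ' {x | 0 < f x}
  have hdensity := withDensity_comp_twoSidedKernel (M := M) κ κ' fun x => ((-f x).toNat : ℝ≥0∞)
  have hpos : (twoSidedKernel κ κ' ∘ₘ M) {w | 0 < f (w 0)} = M {x | 0 < f x} := by
    rw [← Measure.restrict_apply_univ {x | 0 < f x},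
      ← Measure.comp_apply_univ (κ := twoSidedKernel κ κ'), ← hrestrict,
      Measure.restrict_apply_univ]
    rfl
  have hmass : ∫⁻ w, ((-f (w 0)).toNat : ℝ≥0∞) ∂(twoSidedKernel κ κ' ∘ₘ M) =
      M {x | 0 < f x} := by
    rw [← setLIntegral_univ, ← withDensity_apply _ .univ, hdensity, Measure.comp_apply_univ,
      withDensity_apply _ .univ, setLIntegral_univ, lintegral_toNat_neg_eq hf hf0 hf1]
  rw [← hrestrict, ← hdensity]
  refine map_shiftFirstNonpos (measurePreserving_shift hdual) ?_ ?_ (hmass.trans hpos.symm)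
  · have hmeas : MeasurableSet {w | firstNonposTime f w ≠ ⊤} :=
      measurable_firstNonposTime f (measurableSet_singleton ⊤).compl
    refine ae_restrict_of_ae ((Measure.ae_comp_iff hmeas).2 (ae_iff_of_countable.2 fun x hx => ?_))
    exact ae_firstNonposTime_ne_top (survival_eq_zero hrec hM hfin hf hf0 hx)
  · rw [hpos]
    have hsub : {x | 0 < f x} ⊆ {x | 1 ≤ ‖(f x : ℝ)‖} := fun x hx => by
      rw [Set.mem_ofPred_eq, Real.norm_eq_abs]
      exact_mod_cast Int.one_le_abs (ne_of_gt hx)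
    exact ((measure_mono hsub).trans_lt (hf.measure_norm_ge_lt_top one_pos)).ne

end Embedding

section WeightMeasure

variable {S : Type*} [MeasurableSpace S]

/-- The measure on a countable space with point masses given by the weights `w`; negative weights
count as `0`. -/
noncomputable def weightMeasure (w : S → ℝ) : Measure S :=
  Measure.sum fun x => ENNReal.ofReal (w x) • Measure.dirac x

theorem weightMeasure_singleton [MeasurableSingletonClass S] (w : S → ℝ) (x : S) :
    weightMeasure w {x} = ENNReal.ofReal (w x) :=
  Measure.sum_smul_dirac_singleton

theorem weightMeasure_singleton_ne_top [MeasurableSingletonClass S] (w : S → ℝ) (x : S) :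
    weightMeasure w {x} ≠ ∞ :=
  (weightMeasure_singleton w x).trans_ne ENNReal.ofReal_ne_top

theorem weightMeasure_single [DecidableEq S] (i : S) :
    weightMeasure (Pi.single i 1) = Measure.dirac i := by
  refine Measure.ext fun A hA => ?_
  rw [weightMeasure, Measure.sum_apply _ hA, tsum_eq_single i fun x hx => by simp [hx]]
  simp

theorem IsProbability.isProbabilityMeasure_weightMeasure {w : S → ℝ} (hw : IsProbability w) :
    IsProbabilityMeasure (weightMeasure w) := by
  refine ⟨?_⟩
  simp only [weightMeasure, Measure.sum_apply _ .univ, Measure.smul_apply, measure_univ,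
    smul_eq_mul, mul_one]
  rw [← ENNReal.ofReal_tsum_of_nonneg hw.nonneg hw.sum_one.summable, hw.sum_one.tsum_eq,
    ENNReal.ofReal_one]

variable [Countable S] [DiscreteMeasurableSpace S] {w φ : S → ℝ}

theorem integrable_weightMeasure (hw : ∀ x, 0 ≤ w x) (h : Summable fun x => w x * φ x) :
    Integrable φ (weightMeasure w) := by
  refine ⟨Measurable.of_discrete.aestronglyMeasurable, ?_⟩
  have hterm : ∀ x, ‖φ x‖ₑ * weightMeasure w {x} = ENNReal.ofReal |w x * φ x| := fun x => by
    rw [weightMeasure_singleton, abs_mul, abs_of_nonneg (hw x), ENNReal.ofReal_mul (hw x),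
      Real.enorm_eq_ofReal_abs, mul_comm]
  rw [HasFiniteIntegral, lintegral_countable', tsum_congr hterm]
  exact h.abs.tsum_ofReal_lt_top

theorem integral_weightMeasure (hw : ∀ x, 0 ≤ w x) (h : Integrable φ (weightMeasure w)) :
    ∫ x, φ x ∂weightMeasure w = ∑' x, w x * φ x := by
  rw [integral_countable h]
  simp only [measureReal_def, weightMeasure_singleton, ENNReal.toReal_ofReal (hw _), smul_eq_mul]

end WeightMeasure

section StochasticMatrix

variable {S : Type*} {p : Matrix S S ℝ} {m : S → ℝ}

theorem IsStochastic.isProbability (hp : IsStochastic p) (x : S) : IsProbability (p x) :=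
  ⟨hp.nonneg x, hp.row_sum x⟩

theorem IsStochastic.dual (hp : IsStochastic p) (hm : IsStationary p m) :
    IsStochastic (dual p m) where
  nonneg x y := mul_nonneg (div_nonneg (hm.pos y).le (hm.pos x).le) (hp.nonneg y x)
  row_sum x := by
    have hsum := (hm.stationary x).div_const (m x)
    rw [div_self (hm.pos x).ne'] at hsum
    exact hsum.congr_fun fun y => div_mul_eq_mul_div _ _ _

theorem forall_of_isIrreducible_matrix (hirr : p.IsIrreducible) {Q : S → Prop} {y : S} (hy : Q y)
    (hQ : ∀ x z, 0 < p x z → Q z → Q x) (x : S) : Q x := by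
  let : Quiver S := Matrix.toQuiver p
  obtain ⟨path, -⟩ := hirr.connected x y
  induction path with
  | nil => exact hy
  | cons _ e ih => exact ih (hQ _ _ e.down hy)

theorem firstPassage_succ_eq_tsum [DecidableEq S] (i : S) (n : ℕ) (x : S) :
    firstPassage p i (n + 1) x = ∑' y, p x y * Set.indicator {i}ᶜ (firstPassage p i n) y :=
  tsum_congr fun y => by by_cases hy : y = i <;> simp [hy]

variable [MeasurableSpace S] [DiscreteMeasurableSpace S] [Countable S]

/-- The Markov kernel with the transition probabilities `p`. -/
noncomputable def IsStochastic.kernel (_ : IsStochastic p) : Kernel S S :=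
  Kernel.ofFunOfCountable fun x => weightMeasure (p x)

variable (hp : IsStochastic p)

instance : IsMarkovKernel hp.kernel :=
  ⟨fun x => (hp.isProbability x).isProbabilityMeasure_weightMeasure⟩

theorem IsStochastic.kernel_singleton (x y : S) : hp.kernel x {y} = ENNReal.ofReal (p x y) :=
  weightMeasure_singleton (p x) y

theorem IsStochastic.integral_kernel {φ : S → ℝ} {C : ℝ} (hφ : ∀ y, |φ y| ≤ C) (x : S) :
    ∫ y, φ y ∂hp.kernel x = ∑' y, p x y * φ y :=
  integral_weightMeasure (hp.nonneg x) (integrable_of_abs_le (μ := hp.kernel x) hφ)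

theorem IsStationary.invariant (hm : IsStationary p m) : hp.kernel.Invariant (weightMeasure m) := by
  have hterm : ∀ y x, hp.kernel x {y} * weightMeasure m {x} = ENNReal.ofReal (m x * p x y) :=
    fun y x => by
      rw [hp.kernel_singleton, weightMeasure_singleton, ENNReal.ofReal_mul (hm.pos x).le, mul_comm]
  refine Measure.ext_of_singleton fun y => ?_
  rw [Measure.bind_apply (.singleton y) hp.kernel.aemeasurable, lintegral_countable',
    tsum_congr (hterm y), ← ENNReal.ofReal_tsum_of_nonneg
      (fun x => mul_nonneg (hm.pos x).le (hp.nonneg x y)) (hm.stationary y).summable,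
    (hm.stationary y).tsum_eq, weightMeasure_singleton]

theorem IsStochastic.mul_kernel_singleton_eq (hm : IsStationary p m) (x y : S) :
    weightMeasure m {x} * hp.kernel x {y} = weightMeasure m {y} * (hp.dual hm).kernel y {x} := by
  simp only [weightMeasure_singleton, IsStochastic.kernel_singleton, TwoSidedChain.dual,
    ← ENNReal.ofReal_mul (hm.pos _).le]
  congr 1
  field_simp [(hm.pos y).ne']

theorem IsStochastic.isIrreducible_kernel (hirr : p.IsIrreducible) :
    hp.kernel.IsIrreducible Measure.count where
  irreducible A _ hA x := by
    obtain ⟨y, hy⟩ := nonempty_of_measure_ne_zero hA.ne'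
    have hpow : ∃ n, (hp.kernel ^ n) x {y} ≠ 0 := by
      refine forall_of_isIrreducible_matrix hirr (y := y)
        (Q := fun z => ∃ n, (hp.kernel ^ n) z {y} ≠ 0) ⟨0, ?_⟩ ?_ x
      · change Measure.dirac y {y} ≠ 0
        simp
      · rintro z z' hzz' ⟨n, hn⟩
        refine ⟨n + 1, pow_succ_singleton_ne_zero_iff.2 ⟨z', ?_, hn⟩⟩
        rwa [hp.kernel_singleton, ENNReal.ofReal_ne_zero_iff]
    obtain ⟨n, hn⟩ := hpow
    exact ⟨n, (pos_iff_ne_zero.2 hn).trans_le (measure_mono (Set.singleton_subset_iff.2 hy))⟩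

variable [DecidableEq S]

theorem IsStochastic.abs_indicator_firstPassage_le (hp : IsStochastic p) (i : S) (n : ℕ) (x : S) :
    |Set.indicator {i}ᶜ (firstPassage p i n) x| ≤ 1 := by
  suffices hbound : |firstPassage p i n x| ≤ 1 from
    (norm_indicator_le_norm_self (firstPassage p i n) x).trans hbound
  induction n generalizing x with
  | zero =>
    rw [firstPassage, abs_of_nonneg (hp.nonneg x i), ← (hp.row_sum x).tsum_eq]
    exact (hp.row_sum x).summable.le_tsum i fun j _ => hp.nonneg x j
  | succ n ih =>
    have hind : ∀ y, |Set.indicator {i}ᶜ (firstPassage p i n) y| ≤ 1 := fun y =>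
      (norm_indicator_le_norm_self (firstPassage p i n) y).trans (ih y)
    rw [firstPassage_succ_eq_tsum, ← hp.integral_kernel hind]
    exact abs_integral_kernel_le hp.kernel hind x

theorem integral_excursion_firstPassage (i : S) (n k : ℕ) :
    ∫ x, firstPassage p i k x ∂excursion hp.kernel i n = firstPassage p i (n + k) i := by
  induction n generalizing k with
  | zero => rw [excursion, integral_dirac, zero_add]
  | succ n ih =>
    have hind := hp.abs_indicator_firstPassage_le i k
    have hrestrict : (excursion hp.kernel i (n + 1)).restrict {i}ᶜ =
        excursion hp.kernel i (n + 1) := by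
      rw [excursion, Measure.restrict_restrict .of_discrete, Set.inter_self]
    rw [add_right_comm, add_assoc, ← ih (k + 1)]
    simp only [firstPassage_succ_eq_tsum, ← hp.integral_kernel hind]
    rw [integral_excursion_integral_kernel hp.kernel i n hind, integral_indicator .of_discrete,
      hrestrict, Set.indicator_of_notMem (by simp), mul_zero, add_zero]

theorem firstReturn_eq_firstPassage (i : S) (n : ℕ) :
    firstReturn hp.kernel i n = firstPassage p i n i := by
  have hstep : ∀ x, firstPassage p i 0 x = (hp.kernel x).real {i} := fun x => by
    rw [measureReal_def, hp.kernel_singleton, ENNReal.toReal_ofReal (hp.nonneg x i), firstPassage]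
  rw [← add_zero n, ← integral_excursion_firstPassage hp i n 0, add_zero, firstReturn,
    measureReal_def, Measure.bind_apply .of_discrete hp.kernel.aemeasurable]
  simp only [hstep]
  exact (integral_toReal Measurable.of_discrete.aemeasurable
    (ae_of_all _ fun x => measure_lt_top _ _)).symm

theorem IsRecurrent.hasSum_firstReturn (hrec : IsRecurrent p) (i : S) :
    HasSum (firstReturn hp.kernel i) 1 := by
  rw [funext (firstReturn_eq_firstPassage hp i)]
  exact hrec i

end StochasticMatrix

section TwoSidedLaw

variable {S : Type*} [MeasurableSpace S] [DiscreteMeasurableSpace S] [Countable S]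
  {p : Matrix S S ℝ} {m μ : S → ℝ} (hp : IsStochastic p) (hm : IsStationary p m)

/-- The laws of the two-sided Markov chains with transition matrix `p` started at the points of the
state space. -/
noncomputable def twoSidedLaw : Kernel S (ℤ → S) :=
  twoSidedKernel hp.kernel (hp.dual hm).kernel

theorem comp_twoSidedLaw_windowCylinder (hμ : ∀ x, 0 ≤ μ x) (a b : ℕ) (x : ℤ → S) :
    (twoSidedLaw hp hm ∘ₘ weightMeasure μ) (windowCylinder a b x) =
      ENNReal.ofReal (μ (x 0) * (∏ k ∈ Finset.range b, p (x (k : ℤ)) (x ((k : ℤ) + 1))) *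
        ∏ k ∈ Finset.range a, dual p m (x (-(k : ℤ))) (x (-(k : ℤ) - 1))) := by
  have hprod : 0 ≤ ∏ k ∈ Finset.range b, p (x (k : ℤ)) (x ((k : ℤ) + 1)) :=
    Finset.prod_nonneg fun _ _ => hp.nonneg _ _
  rw [twoSidedLaw, comp_twoSidedKernel_windowCylinder]
  simp only [weightMeasure_singleton, IsStochastic.kernel_singleton]
  rw [ENNReal.ofReal_mul (mul_nonneg (hμ _) hprod), ENNReal.ofReal_mul (hμ _),
    ENNReal.ofReal_prod_of_nonneg fun _ _ => hp.nonneg _ _,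
    ENNReal.ofReal_prod_of_nonneg fun _ _ => (hp.dual hm).nonneg _ _]

theorem isTwoSidedMarkovChain_iff (hμ : ∀ x, 0 ≤ μ x) {Ω : Type*} [MeasurableSpace Ω]
    {X : ℤ → Ω → S} {P : Measure Ω} [IsFiniteMeasure P] :
    IsTwoSidedMarkovChain p m μ X P ↔ Measurable (fun ω n => X n ω) ∧
      P.map (fun ω n => X n ω) = twoSidedLaw hp hm ∘ₘ weightMeasure μ := by
  have hcyl : Measurable (fun ω n => X n ω) → ∀ (a b : ℕ) (x : ℤ → S),
      P {ω | ∀ k : ℤ, -(a : ℤ) ≤ k → k ≤ (b : ℤ) → X k ω = x k} =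
        P.map (fun ω n => X n ω) (windowCylinder a b x) := fun hX a b x =>
    (Measure.map_apply hX (measurableSet_windowCylinder a b x)).symm
  constructor
  · intro h
    have hX : Measurable fun ω n => X n ω := measurable_pi_iff.2 h.measurable
    refine ⟨hX, eq_of_windowCylinder fun N x => ?_⟩
    rw [comp_twoSidedLaw_windowCylinder hp hm hμ, ← h.cylinder, ofReal_measureReal, hcyl hX]
  · rintro ⟨hX, hlaw⟩
    refine ⟨measurable_pi_iff.1 hX, fun a b x => ?_⟩
    rw [measureReal_def, hcyl hX, hlaw, comp_twoSidedLaw_windowCylinder hp hm hμ,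
      ENNReal.toReal_ofReal]
    exact mul_nonneg (mul_nonneg (hμ _) (Finset.prod_nonneg fun _ _ => hp.nonneg _ _))
      (Finset.prod_nonneg fun _ _ => (hp.dual hm).nonneg _ _)

end TwoSidedLaw

section Charge

variable {S : Type*} {m ν : S → ℝ} {i : S}

theorem exists_mul_natCast_eq (hm : ∀ j, 0 < m j) (hν : ∀ j, 0 ≤ ν j)
    (hint : ∀ j, ∃ z : ℤ, m i / m j * ν j = z) : ∃ c : S → ℕ, ∀ j, m j * c j = m i * ν j := by
  choose z hz using hint
  refine ⟨fun j => (z j).toNat, fun j => ?_⟩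
  have hz0 : 0 ≤ z j := by
    have h := mul_nonneg (div_nonneg (hm i).le (hm j).le) (hν j)
    rw [hz] at h
    exact_mod_cast h
  rw [← Int.cast_natCast, Int.toNat_of_nonneg hz0, ← hz]
  field_simp [(hm j).ne']

theorem apply_self_eq_zero (hm : ∀ j, 0 < m j) (hνi : ν i = 0) {c : S → ℕ}
    (hc : ∀ j, m j * c j = m i * ν j) : c i = 0 := by
  have h := hc i
  rw [hνi, mul_zero] at h
  exact_mod_cast (mul_eq_zero.1 h).resolve_left (hm i).ne'

variable [DecidableEq S] {c : S → ℕ}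

/-- The increments, multiplied by `m i`, of the walk `Lⁱ - ∑ⱼ νⱼ Lʲ` stopped by `Tstar`, where
`c j = m i / m j * ν j`: a visit to `i` counts `1`, a visit to `j ≠ i` counts `-c j`. -/
def charge (i : S) (c : S → ℕ) (x : S) : ℤ :=
  (if x = i then 1 else 0) - c x

theorem charge_le_one (i : S) (c : S → ℕ) (x : S) : charge i c x ≤ 1 := by
  grind [charge]

theorem setOf_charge_pos (hci : c i = 0) : {x | 0 < charge i c x} = {i} := by
  ext x
  simp only [charge, Set.mem_ofPred_eq, Set.mem_singleton_iff]
  grind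

theorem toNat_neg_charge (hci : c i = 0) (x : S) : (-charge i c x).toNat = c x := by
  grind [charge]

theorem hasSum_mul_charge (hν : HasSum ν 1) (hc : ∀ j, m j * c j = m i * ν j) :
    HasSum (fun x => m x * (charge i c x : ℝ)) 0 := by
  have hvisit : HasSum (fun x => if x = i then m i else 0) (m i) := hasSum_ite_eq i (m i)
  have hmass : HasSum (fun x => m x * (c x : ℝ)) (m i) := by
    simpa only [hc, mul_one] using hν.mul_left (m i)
  rw [← sub_self (m i)]
  refine (hvisit.sub hmass).congr_fun fun x => ?_
  by_cases hx : x = i <;> simp [charge, hx, mul_sub]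

theorem localTime_eq_sum (m : S → ℝ) (w : ℤ → S) (j : S) (n : ℕ) :
    localTime m w j (Finset.Icc 0 (n : ℤ)) =
      ∑ k ∈ Finset.range (n + 1), if j = w k then 1 / m j else 0 := by
  have hIcc : Finset.Icc 0 (n : ℤ) = (Finset.range (n + 1)).map Nat.castEmbedding := by
    ext k
    simp only [Finset.mem_Icc, Finset.mem_map, Finset.mem_range, Nat.castEmbedding_apply]
    exact ⟨fun h => ⟨k.toNat, by lia, by lia⟩, by rintro ⟨l, h, rfl⟩; lia⟩
  rw [localTime, hIcc, Finset.filter_map, Finset.card_map, Finset.card_filter, Nat.cast_sum,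
    Finset.sum_div]
  refine Finset.sum_congr rfl fun k _ => ?_
  by_cases h : j = w k
  · simp [← h]
  · simp [h, Ne.symm h]

theorem tsum_mul_localTime (m ν : S → ℝ) (w : ℤ → S) (n : ℕ) :
    ∑' j, ν j * localTime m w j (Finset.Icc 0 (n : ℤ)) =
      ∑ k ∈ Finset.range (n + 1), ν (w k) / m (w k) := by
  have hsum : HasSum (fun j => ∑ k ∈ Finset.range (n + 1),
      if j = w k then ν (w k) / m (w k) else 0) (∑ k ∈ Finset.range (n + 1), ν (w k) / m (w k)) :=
    hasSum_sum fun k _ => hasSum_ite_eq (w k) (ν (w k) / m (w k))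
  rw [← hsum.tsum_eq]
  refine tsum_congr fun j => ?_
  rw [localTime_eq_sum, Finset.mul_sum]
  refine Finset.sum_congr rfl fun k _ => ?_
  split_ifs with hj
  · rw [← hj, mul_one_div]
  · rw [mul_zero]

theorem mul_localTime_sub_tsum (hm : ∀ j, 0 < m j) (hc : ∀ j, m j * c j = m i * ν j) (w : ℤ → S)
    (n : ℕ) :
    m i * (localTime m w i (Finset.Icc 0 (n : ℤ)) -
      ∑' j, ν j * localTime m w j (Finset.Icc 0 (n : ℤ))) = partialSum (charge i c) w n := by
  rw [tsum_mul_localTime, localTime_eq_sum, ← Finset.sum_sub_distrib, Finset.mul_sum, partialSum,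
    Int.cast_sum]
  refine Finset.sum_congr rfl fun k _ => ?_
  have hcharge : m i * (ν (w k) / m (w k)) = c (w k) := by
    rw [← mul_div_assoc, ← hc, mul_div_cancel_left₀ _ (hm _).ne']
  rw [mul_sub, hcharge, charge]
  simp [eq_comm, (hm i).ne']

theorem Tstar_eq_firstNonposTime (hm : ∀ j, 0 < m j) (hc : ∀ j, m j * c j = m i * ν j) :
    Tstar m ν i = firstNonposTime (charge i c) := by
  have hiff : ∀ (w : ℤ → S) (n : ℕ), localTime m w i (Finset.Icc 0 (n : ℤ)) ≤
      ∑' j, ν j * localTime m w j (Finset.Icc 0 (n : ℤ)) ↔ partialSum (charge i c) w n ≤ 0 :=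
    fun w n => by
      rw [← sub_nonpos, ← Int.cast_nonpos (R := ℝ), ← mul_localTime_sub_tsum hm hc]
      exact ⟨mul_nonpos_of_nonneg_of_nonpos (hm i).le, fun h => nonpos_of_mul_nonpos_right h (hm i)⟩
  funext w
  simp only [Tstar, firstNonposTime, hiff]

end Charge

section Tstar

variable {S : Type*} [MeasurableSpace S] [DiscreteMeasurableSpace S] [Countable S]
  {p : Matrix S S ℝ} {m ν : S → ℝ} {i : S} {c : S → ℕ}

theorem withDensity_weightMeasure (hm : ∀ j, 0 ≤ m j) (hc : ∀ j, m j * c j = m i * ν j) :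
    (weightMeasure m).withDensity (fun x => (c x : ℝ≥0∞)) =
      ENNReal.ofReal (m i) • weightMeasure ν := by
  refine Measure.ext_of_singleton fun x => ?_
  rw [withDensity_apply _ .of_discrete, Measure.restrict_singleton, lintegral_smul_measure,
    lintegral_dirac, Measure.smul_apply, weightMeasure_singleton, weightMeasure_singleton,
    smul_eq_mul, smul_eq_mul, ← ENNReal.ofReal_natCast, ← ENNReal.ofReal_mul (hm x), hc,
    ENNReal.ofReal_mul (hm i)]

variable [DecidableEq S]

theorem integrable_charge (hm : ∀ j, 0 ≤ m j) (hν : HasSum ν 1)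
    (hc : ∀ j, m j * c j = m i * ν j) :
    Integrable (fun x => (charge i c x : ℝ)) (weightMeasure m) :=
  integrable_weightMeasure hm (hasSum_mul_charge hν hc).summable

theorem integral_charge (hm : ∀ j, 0 ≤ m j) (hν : HasSum ν 1)
    (hc : ∀ j, m j * c j = m i * ν j) : ∫ x, (charge i c x : ℝ) ∂weightMeasure m = 0 :=
  (integral_weightMeasure hm (integrable_charge hm hν hc)).trans (hasSum_mul_charge hν hc).tsum_eq

theorem ae_twoSidedLaw_firstNonposTime_ne_top (hp : IsStochastic p) (hirr : p.IsIrreducible)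
    (hrec : IsRecurrent p) (hm : IsStationary p m) (hν : HasSum ν 1)
    (hc : ∀ j, m j * c j = m i * ν j) :
    ∀ᵐ w ∂twoSidedLaw hp hm i, firstNonposTime (charge i c) w ≠ ⊤ := by
  have := hp.isIrreducible_kernel hirr
  have hnonneg := fun j => (hm.pos j).le
  refine ae_firstNonposTime_ne_top (survival_eq_zero (hrec.hasSum_firstReturn hp) (hm.invariant hp)
    (weightMeasure_singleton_ne_top m) (integrable_charge hnonneg hν hc)
    (integral_charge hnonneg hν hc) ?_)
  rw [weightMeasure_singleton, ENNReal.ofReal_ne_zero_iff]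
  exact hm.pos i

theorem map_shiftFirstNonpos_charge (hp : IsStochastic p) (hirr : p.IsIrreducible)
    (hrec : IsRecurrent p) (hm : IsStationary p m) (hν : HasSum ν 1)
    (hc : ∀ j, m j * c j = m i * ν j) (hci : c i = 0) :
    (twoSidedLaw hp hm i).map (shiftFirstNonpos (charge i c)) =
      twoSidedLaw hp hm ∘ₘ weightMeasure ν := by
  have := hp.isIrreducible_kernel hirr
  have hnonneg := fun j => (hm.pos j).le
  have hscaled := map_shiftFirstNonpos_comp_twoSidedKernel (hrec.hasSum_firstReturn hp)
    (hm.invariant hp) (weightMeasure_singleton_ne_top m) (hp.mul_kernel_singleton_eq hm)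
    (integrable_charge hnonneg hν hc) (integral_charge hnonneg hν hc) (charge_le_one i c)
  simp only [setOf_charge_pos hci, toNat_neg_charge hci] at hscaled
  rw [withDensity_weightMeasure hnonneg hc, Measure.restrict_singleton, weightMeasure_singleton,
    Measure.comp_smul, Measure.comp_smul, Measure.map_smul, Measure.dirac_bind
    (Kernel.measurable _)] at hscaled
  refine Measure.ext fun A _ => ?_
  refine (ENNReal.mul_right_inj (ENNReal.ofReal_ne_zero_iff.2 (hm.pos i))
    ENNReal.ofReal_ne_top).1 ?_
  exact congrArg (fun μ : Measure (ℤ → S) => μ A) hscaled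

end Tstar

section StoppingTime

variable {S Ω : Type*} [MeasurableSpace S] [MeasurableSpace Ω] {X : ℤ → Ω → S}

theorem measurable_forwardFiltration (hX : ∀ n, Measurable (X n)) {k n : ℕ} (hk : k ≤ n) :
    Measurable[forwardFiltration X hX n] (X k) :=
  (comap_measurable (X k)).mono
    (le_iSup₂ (f := fun (k : ℕ) (_ : k ≤ n) => MeasurableSpace.comap (X k) inferInstance) k hk)
    le_rfl

theorem isStoppingTime_firstNonposTime [DiscreteMeasurableSpace S] (f : S → ℤ)
    (hX : ∀ n, Measurable (X n)) :
    IsStoppingTime (forwardFiltration X hX) fun ω => firstNonposTime f fun n => X n ω := fun n =>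
  @measurableSet_firstNonposTime_le S f _ _ Ω (forwardFiltration X hX n) X n
    fun _ hk => measurable_forwardFiltration hX hk

end StoppingTime

end TwoSidedChain

theorem theorem2 {S : Type*} [Countable S] [DecidableEq S] [MeasurableSpace S]
    [DiscreteMeasurableSpace S] {Ω : Type*} [MeasurableSpace Ω]
    (p : Matrix S S ℝ) (hp : TwoSidedChain.IsStochastic p) (hirr : p.IsIrreducible)
    (hrec : TwoSidedChain.IsRecurrent p)
    (m : S → ℝ) (hm : TwoSidedChain.IsStationary p m)
    (i : S) (X : ℤ → Ω → S) (P : Measure Ω) [IsProbabilityMeasure P]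
    (hX : TwoSidedChain.IsTwoSidedMarkovChain p m (Pi.single i 1) X P)
    (ν : S → ℝ) (hν : TwoSidedChain.IsProbability ν) (hνi : ν i = 0)
    (hint : ∀ j, ∃ z : ℤ, m i / m j * ν j = (z : ℝ)) :
    -- `T_*` is almost surely finite
    (∀ᵐ ω ∂P, TwoSidedChain.Tstar m ν i (fun n => X n ω) ≠ ⊤) ∧
    -- `T_*` is non-randomized: a measurable function of the trajectory
    Measurable (TwoSidedChain.Tstar m ν i) ∧
    -- `T_*` is a stopping time
    IsStoppingTime (TwoSidedChain.forwardFiltration X hX.measurable)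
      (fun ω => TwoSidedChain.Tstar m ν i (fun n => X n ω)) ∧
    -- `T_*` is an unbiased shift embedding `ν`
    TwoSidedChain.IsTwoSidedMarkovChain p m ν
      (fun n ω => X (n + ((TwoSidedChain.Tstar m ν i (fun k => X k ω)).toNat : ℤ)) ω) P := by
  obtain ⟨c, hc⟩ := TwoSidedChain.exists_mul_natCast_eq hm.pos hν.nonneg hint
  have hci := TwoSidedChain.apply_self_eq_zero hm.pos hνi hc
  have hsingle : (0 : S → ℝ) ≤ Pi.single i 1 := Pi.single_nonneg.2 zero_le_one
  obtain ⟨hmeas, hlaw⟩ := (TwoSidedChain.isTwoSidedMarkovChain_iff hp hm hsingle).1 hX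
  rw [TwoSidedChain.weightMeasure_single, Measure.dirac_bind (Kernel.measurable _)] at hlaw
  have hshift := TwoSidedChain.measurable_shiftFirstNonpos (TwoSidedChain.charge i c)
  rw [TwoSidedChain.Tstar_eq_firstNonposTime hm.pos hc]
  refine ⟨?_, TwoSidedChain.measurable_firstNonposTime _,
    TwoSidedChain.isStoppingTime_firstNonposTime _ hX.measurable,
    (TwoSidedChain.isTwoSidedMarkovChain_iff hp hm hν.nonneg).2 ⟨hshift.comp hmeas, ?_⟩⟩
  · have hfin := TwoSidedChain.ae_twoSidedLaw_firstNonposTime_ne_top hp hirr hrec hm hν.sum_one hc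
    rw [← hlaw] at hfin
    exact ae_of_ae_map hmeas.aemeasurable hfin
  · rw [← TwoSidedChain.map_shiftFirstNonpos_charge hp hirr hrec hm hν.sum_one hc hci, ← hlaw,
      Measure.map_map hshift hmeas]
    rfl
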